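/- Logarithms $\log$ are to base $2$. Algorithms are deterministic and comparison-based, and the average number of comparisons on $n$ elements refers to the uniform distribution on the orderings of $n$ distinct elements. QuickMergeXsort sorts an array as follows. As long as the current subarray (of $s$ elements) is non-empty, a sample from it is taken, the median of the sample (the lower one for even sample size) is chosen as pivot, and the subarray is partitioned by comparing the elements outside the sample with the pivot. One of the two sides (chosen by any fixed rule according to their sizes) is sorted with MergeXsort, and the algorithm continues with the other side. With Median-of-$\sqrt n$ pivot selection the sample consists of $\lceil\sqrt s\rceil$ elements; with Median-of-3 pivot selection it consists of $\min(3,s)$ elements. The median of a sample of $m$ elements is found by any procedure that uses $O(m^2)$ comparisons on average. MergeXsort is top-down Mergesort (recursive halving and standard merging) which hands a piece to the sorting algorithm X when reaching $\lceil n^\beta\rceil$ elements: only pieces of at most $\lceil n^\beta\rceil$ elements (or of at most one element) are handed to X, and a piece is handed to X at the latest when it has at most $m^\beta/2$ elements. Here $n$ is the size of the whole array and $m\le n$ the size of the side handed to MergeXsort; so the threshold may be $\lceil n^\beta\rceil$ or $\lceil m^\beta\rceil$, or one may stop on all branches at recursion depth $\lceil(1-\beta)\log m\rceil$. The positions of the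 sample, and the order in which the elements of a side stand after the partitioning (and, for the side sorted last, after the other side has been sorted), are arbitrary, as long as they do not depend on the relative order of the keys within that side; they may depend on the original positions of the elements, on the outcome of the partitioning and on the result of sorting the other side. Theorem. Let $0<\beta<1$ and let X be a sorting algorithm that needs at most $\alpha\, n\log n + cn + o(n)$ comparisons on average. Then QuickMergeXsort, with Median-of-$\sqrt n$ as well as with Median-of-3 pivot selection, is a sorting algorithm that needs at most $$(\alpha\beta+(1-\beta))\, n\log n + O(n)$$ comparisons on average, where the constant in $O(n)$ does not depend on $n$, on the choice of the sides, on the stopping rule or on the placement of the elements. In particular, for $\beta=1/2$ and X $=$ CleverQuicksort (Quicksort whose pivot is the median of three elements), QuickMergeXsort with either pivot selection is a sorting algorithm that needs at most $$\tfrac12\left(1+\tfrac{12}{7}\ln 2\right) n\log n + O(n)$$ comparisons on average, and $\left|\tfrac12\left(1+\tfrac{12}{7}\ln 2\right)-1.094\right|<1/2000$. -/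

import Mathlib

open Filter Asymptotics

namespace QuickMergeX

/-- A comparison-based program that accesses keys only through the names `i : ι` of the elements:
`cmp i j yes no` compares the elements `i` and `j` and goes on with `yes` if the key of `i` is
strictly smaller than the key of `j`, and with `no` otherwise; `ret b` stops with the result `b`. -/
inductive CompTree (ι β : Type) : Type where
  | ret : β → CompTree ι β
  | cmp : ι → ι → CompTree ι β → CompTree ι β → CompTree ι β

namespace CompTree

variable {ι ι' β γ : Type}

/-- Run a program, then go on with its result. -/
def bind : CompTree ι β → (β → CompTree ι γ) → CompTree ι γ
  | ret b, f => f b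
  | cmp i j yes no, f => cmp i j (bind yes f) (bind no f)

instance : Monad (CompTree ι) where
  pure := ret
  bind := bind

/-- The same program, working on the elements `f i` in place of the elements `i`. -/
def relabel (f : ι → ι') : CompTree ι β → CompTree ι' β
  | ret b => ret b
  | cmp i j yes no => cmp (f i) (f j) (relabel f yes) (relabel f no)

/-- The result of the program if the elements have the keys `a`. -/
def result {κ : Type} [LinearOrder κ] (a : ι → κ) : CompTree ι β → β
  | ret b => b
  | cmp i j yes no => if a i < a j then result a yes else result a no

/-- The number of comparisons that the program performs if the elements have the keys `a`. -/
def cost {κ : Type} [LinearOrder κ] (a : ι → κ) : CompTree ι β → ℕ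
  | ret _ => 0
  | cmp i j yes no => (if a i < a j then cost a yes else cost a no) + 1

/-- The average number of comparisons: all orderings of `n` distinct keys are equally likely. -/
noncomputable def avgCost {n : ℕ} (t : CompTree (Fin n) β) : ℝ :=
  (∑ π : Equiv.Perm (Fin n), (t.cost π : ℝ)) / (n.factorial : ℝ)

/-- The program sorts `n` elements: for all keys (equal keys are allowed), it returns the list of
all elements in an order in which the keys are non-decreasing. -/
def Sorts {n : ℕ} (t : CompTree (Fin n) (List (Fin n))) : Prop :=
  ∀ (κ : Type) [LinearOrder κ] (a : Fin n → κ),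
    (t.result a).Perm (List.finRange n) ∧ ((t.result a).map a).Pairwise (· ≤ ·)

/-- The program finds the (lower) median of `m + 1` elements. It returns an element `p` and marks
`m / 2` of the other elements; the marked ones are at most `p`, the unmarked ones at least `p`. -/
def FindsMedian {m : ℕ} (t : CompTree (Fin (m + 1)) (Fin (m + 1) × (Fin (m + 1) → Bool))) : Prop :=
  ∀ (κ : Type) [LinearOrder κ] (a : Fin (m + 1) → κ),
    (∀ i, i ≠ (t.result a).1 → (t.result a).2 i = true → a i ≤ a (t.result a).1) ∧
    (∀ i, i ≠ (t.result a).1 → (t.result a).2 i = false → a (t.result a).1 ≤ a i) ∧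
    (Finset.univ.filter fun i => i ≠ (t.result a).1 ∧ (t.result a).2 i = true).card = m / 2

end CompTree

/-- A comparison-based sorting procedure, one program for every number of elements. -/
abbrev Sorter : Type := ∀ n : ℕ, CompTree (Fin n) (List (Fin n))

/-- A procedure for medians, one program for every positive number of elements. -/
abbrev MedianFinder : Type :=
  ∀ m : ℕ, CompTree (Fin (m + 1)) (Fin (m + 1) × (Fin (m + 1) → Bool))

section Programs

variable {ι : Type}

/-- Apply a sorting procedure to the elements of a list. -/
def sortList (X : Sorter) (l : List ι) : CompTree ι (List ι) := do
  let o ← (X l.length).relabel l.get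
  pure (o.map l.get)

/-- Merge two sorted lists. -/
def merge : List ι → List ι → CompTree ι (List ι)
  | [], ys => pure ys
  | x :: xs, [] => pure (x :: xs)
  | x :: xs, y :: ys =>
      .cmp x y
        (do let zs ← merge xs (y :: ys); pure (x :: zs))
        (do let zs ← merge (x :: xs) ys; pure (y :: zs))
termination_by xs ys => xs.length + ys.length

/-- Mergesort with recursion stopper `X`: a list of size `s` at recursion depth `d` is handed to
`X` if `s ≤ 1` or `callX d s`, and otherwise its two halves are sorted recursively and merged. -/
def mergeXsort (X : Sorter) (callX : ℕ → ℕ → Bool) (d : ℕ) (l : List ι) : CompTree ι (List ι) :=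
  if l.length ≤ 1 ∨ callX d l.length = true then sortList X l
  else do
    let second ← mergeXsort X callX (d + 1) (l.drop (l.length / 2))
    let first ← mergeXsort X callX (d + 1) (l.take (l.length / 2))
    merge first second
termination_by l.length
decreasing_by
  · simp only [List.length_drop]; omega
  · simp only [List.length_take]; omega

/-- A list that is split by a pivot. -/
structure Split (ι : Type) where
  less : List ι
  pivot : ι
  greater : List ι

/-- Split the non-empty sample `x :: xs` by its median. -/
def splitSample (sel : MedianFinder) (x : ι) (xs : List ι) : CompTree ι (Split ι) := do
  let r ← (sel xs.length).relabel (x :: xs).get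
  pure {
    less := ((List.finRange (xs.length + 1)).filter
      fun i => decide (i ≠ r.1) && r.2 i).map (x :: xs).get
    pivot := (x :: xs).get r.1
    greater := ((List.finRange (xs.length + 1)).filter
      fun i => decide (i ≠ r.1) && !(r.2 i)).map (x :: xs).get }

/-- Compare each of the remaining elements with the pivot, and put it on its side. -/
def splitRest : Split ι → List ι → CompTree ι (Split ι)
  | S, [] => pure S
  | S, y :: ys =>
      .cmp y S.pivot
        (splitRest { S with less := S.less ++ [y] } ys)
        (splitRest { S with greater := S.greater ++ [y] } ys)

/-- Partition the list `x :: xs` by the median of its first `k` elements (of all its elements, if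
there are fewer than `k`). -/
def partition (sel : MedianFinder) (k : ℕ) (x : ι) (xs : List ι) : CompTree ι (Split ι) := do
  let S ← splitSample sel x (xs.take (k - 1))
  splitRest S (xs.drop (k - 1))

end Programs

/-- The implementation-dependent movement of elements, by which no element gets lost and which
does not look at keys.

* `pick l` is a rearrangement of the subarray `l`; its first elements serve as the pivot sample,
  so that the sample may be taken from any positions.
* `move l S done t` is the order in which the elements of the side `t` of the subarray `l` stand
  in the array when it is their turn, where `S` is the outcome of the partitioning, and `done` is
  the other side in sorted order, if it was sorted before (and `[]` otherwise). So the order within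
  a side depends on the partitioning method and, if the side served as temporary space for sorting
  the other side, also on that. -/
structure DataMovement (n : ℕ) where
  pick : List (Fin n) → List (Fin n)
  pick_perm : ∀ l, (pick l).Perm l
  move : List (Fin n) → Split (Fin n) → List (Fin n) → List (Fin n) → List (Fin n)
  move_perm : ∀ l S done t, (move l S done t).Perm t

/-- The main loop of QuickMergeXsort. The first argument bounds the number of rounds; every round
removes at least the pivot, so that the length of the list is enough.

The subarray is partitioned by the median of a sample of size `sampleSize s`, where `s` is its
size. Then one of the sides, chosen by `useLess` according to the two sizes, is sorted with
Mergesort with recursion stopper `X`, and the other side recursively. For a side of size `s` handed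
to Mergesort, `callX s` is the stopping rule. -/
def quickMergeXsortAux (sel : MedianFinder) (sampleSize : ℕ → ℕ) (X : Sorter) {n : ℕ}
    (D : DataMovement n) (useLess : ℕ → ℕ → Bool) (callX : ℕ → ℕ → ℕ → Bool) :
    ℕ → List (Fin n) → CompTree (Fin n) (List (Fin n))
  | 0, _ => pure []
  | fuel + 1, l =>
      match D.pick l with
      | [] => pure []
      | x :: xs => do
          let S ← partition sel (sampleSize l.length) x xs
          if useLess S.less.length S.greater.length then
            let u ← mergeXsort X (callX S.less.length) 0 (D.move l S [] S.less)
            let v ← quickMergeXsortAux sel sampleSize X D useLess callX fuel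
              (D.move l S u S.greater)
            pure (u ++ S.pivot :: v)
          else
            let v ← mergeXsort X (callX S.greater.length) 0 (D.move l S [] S.greater)
            let u ← quickMergeXsortAux sel sampleSize X D useLess callX fuel
              (D.move l S v S.less)
            pure (u ++ S.pivot :: v)

/-- QuickMergeXsort on `n` elements. -/
def quickMergeXsort (sel : MedianFinder) (sampleSize : ℕ → ℕ) (X : Sorter) (n : ℕ)
    (D : DataMovement n) (useLess : ℕ → ℕ → Bool) (callX : ℕ → ℕ → ℕ → Bool) :
    CompTree (Fin n) (List (Fin n)) :=
  quickMergeXsortAux sel sampleSize X D useLess callX n (List.finRange n)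

/-- The recursion of CleverQuicksort: Quicksort where the pivot is the median of three elements.
The first argument bounds the recursion depth. -/
def cleverQuicksortAux (sel : MedianFinder) {n : ℕ} (D : DataMovement n) :
    ℕ → List (Fin n) → CompTree (Fin n) (List (Fin n))
  | 0, _ => pure []
  | fuel + 1, l =>
      match D.pick l with
      | [] => pure []
      | x :: xs => do
          let S ← partition sel 3 x xs
          let u ← cleverQuicksortAux sel D fuel (D.move l S [] S.less)
          let v ← cleverQuicksortAux sel D fuel (D.move l S [] S.greater)
          pure (u ++ S.pivot :: v)

/-- CleverQuicksort. -/
def cleverQuicksort (sel : MedianFinder) (D : ∀ n, DataMovement n) : Sorter :=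
  fun n => cleverQuicksortAux sel (D n) n (List.finRange n)

/-- The rule `callX` lets Mergesort call `X` upon reaching about `n ^ β` elements. Here `callX m d s`
decides whether a piece of size `s` at recursion depth `d` is handed to `X`, inside a call of
Mergesort on `m ≤ n` elements, during the sorting of `n` elements. Only pieces of size at most
`⌈n ^ β⌉` are handed to `X`, and a piece is handed to `X` at the latest when its size is at most
`m ^ β / 2`.

This allows for the threshold `⌈m ^ β⌉` as well as for `⌈n ^ β⌉`, and for stopping on all branches
at the same depth `⌈(1 - β) * log₂ m⌉`. -/
def StopsAtPower (β : ℝ) (n : ℕ) (callX : ℕ → ℕ → ℕ → Bool) : Prop :=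
  ∀ m d s : ℕ, m ≤ n →
    (callX m d s = true → s ≤ ⌈(n : ℝ) ^ β⌉₊) ∧
    (2 * (s : ℝ) ≤ (m : ℝ) ^ β → callX m d s = true)

end QuickMergeX

/-!
The average number of comparisons is a mean over all keys `π : Equiv.Perm (Fin n)`, also for the
subarrays; no distribution on smaller sets of orderings is carried along. This rests on two facts.
All relative orders of given elements are equally likely, even conditional on an event that is
invariant under permuting the keys of these elements among themselves (`sum_order_pattern`). And,
for distinct keys, the outcome of a partitioning step consists of the smaller and the larger
elements, each in their old order, around the median of the sample (`partition_eq_filter`), so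
that it is invariant under permuting the keys within a side (`partition_result_mul`). Hence both
sides are sorted at their unconditional average cost (`sum_cost_of_choice`); for the side sorted
last this holds although its arrangement may depend on the result of sorting the other side, as
this result depends only on the order of the other side.

Mergesort on `m ≤ n` elements costs on average at most `m * γ` with
`γ = (α * β + (1 - β)) * log n + O(1)`: a piece of size `s` that is handed to `X` saves `log s`
comparisons per element of merging, where `X` needs `α * log s + O(1)` instead. This is a loss of
`(α - 1) * log s ≤ (α - 1) * β * log n + O(1)` per element, because `α ≥ 1` by the
information-theoretic lower bound (`one_le_of_avgCost_le`) and `s ≤ ⌈n ^ β⌉`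
(`mergeXsort_avgCost_le`).

In the main loop every element except the pivots passes through Mergesort at most once, which
costs `γ * n` in total. Partitioning costs `O(s)` on `s` elements, the quadratic median search on
a sample of size `O(√s)` included, and the larger side has on average at most `15 / 16 * s`
elements (`sum_max_rank_le`), whichever side is taken. So all partitioning steps together cost
`O(n)` (`quickMergeXsortAux_avgCost_le`).

For CleverQuicksort the median of three elements has rank `k` among `s` elements with probability
`6 * k * (s - 1 - k) / (s * (s - 1) * (s - 2))` (`sum_rank_median_three_le`), and the function
`12 / 7 * (s + 1) * H_s + B * s`, with the harmonic numbers `H_s`, satisfies the resulting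
recurrence up to a constant that a large `B` absorbs (`sum_median_cleverBound`).
-/

namespace QuickMergeX

/-! ### Running programs -/

namespace CompTree

variable {ι ι' β γ κ : Type} [LinearOrder κ]

@[simp] lemma result_pure (a : ι → κ) (b : β) : (pure b : CompTree ι β).result a = b := rfl

@[simp] lemma cost_pure (a : ι → κ) (b : β) : (pure b : CompTree ι β).cost a = 0 := rfl

@[simp] lemma result_bind (a : ι → κ) (t : CompTree ι β) (f : β → CompTree ι γ) :
    (t >>= f).result a = (f (t.result a)).result a := by
  change (t.bind f).result a = _
  induction t with
  | ret b => rfl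
  | cmp i j yes no h1 h2 =>
    simp only [CompTree.bind, result]
    split_ifs <;> assumption

@[simp] lemma cost_bind (a : ι → κ) (t : CompTree ι β) (f : β → CompTree ι γ) :
    (t >>= f).cost a = t.cost a + (f (t.result a)).cost a := by
  change (t.bind f).cost a = _
  induction t with
  | ret b => simp [CompTree.bind, result, cost]
  | cmp i j yes no h1 h2 =>
    simp only [CompTree.bind, result, cost]
    split_ifs <;> simp [*] <;> omega

@[simp] lemma result_relabel (a : ι' → κ) (f : ι → ι') (t : CompTree ι β) :
    (t.relabel f).result a = t.result (a ∘ f) := by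
  induction t with
  | ret b => rfl
  | cmp i j yes no h1 h2 => simp [relabel, result, h1, h2]

@[simp] lemma cost_relabel (a : ι' → κ) (f : ι → ι') (t : CompTree ι β) :
    (t.relabel f).cost a = t.cost (a ∘ f) := by
  induction t with
  | ret b => rfl
  | cmp i j yes no h1 h2 => simp [relabel, cost, h1, h2]

lemma result_congr {κ' : Type} [LinearOrder κ'] (a : ι → κ) (b : ι → κ')
    (h : ∀ i j, a i < a j ↔ b i < b j) (t : CompTree ι β) : t.result a = t.result b := by
  induction t with
  | ret b => rfl
  | cmp i j yes no h1 h2 => simp [result, h, h1, h2]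

lemma cost_congr {κ' : Type} [LinearOrder κ'] (a : ι → κ) (b : ι → κ')
    (h : ∀ i j, a i < a j ↔ b i < b j) (t : CompTree ι β) : t.cost a = t.cost b := by
  induction t with
  | ret b => rfl
  | cmp i j yes no h1 h2 => simp [cost, h, h1, h2]

/-- The result and the cost of the program depend only on the relative order of the keys of the
elements of `S`. The key type `κ` is fixed. -/
def DependsOn (κ : Type) [LinearOrder κ] (S : Set ι) (t : CompTree ι β) : Prop :=
  ∀ a b : ι → κ, (∀ i ∈ S, ∀ j ∈ S, a i < a j ↔ b i < b j) →
    t.result a = t.result b ∧ t.cost a = t.cost b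

lemma dependsOn_pure (S : Set ι) (b : β) : DependsOn κ S (pure b : CompTree ι β) :=
  fun _ _ _ => ⟨rfl, rfl⟩

lemma DependsOn.bind {S : Set ι} {t : CompTree ι β} {f : β → CompTree ι γ}
    (ht : DependsOn κ S t) (hf : ∀ a : ι → κ, DependsOn κ S (f (t.result a))) :
    DependsOn κ S (t >>= f) := by
  intro a b hab
  obtain ⟨h1, h2⟩ := ht a b hab
  obtain ⟨h3, h4⟩ := hf a a b hab
  simp [← h1, h2, h3, h4]

lemma DependsOn.mono {S T : Set ι} (hST : S ⊆ T) {t : CompTree ι β} (ht : DependsOn κ S t) :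
    DependsOn κ T t :=
  fun a b hab => ht a b fun i hi j hj => hab i (hST hi) j (hST hj)

lemma DependsOn.cmp {S : Set ι} {i j : ι} (hi : i ∈ S) (hj : j ∈ S) {yes no : CompTree ι β}
    (h1 : DependsOn κ S yes) (h2 : DependsOn κ S no) : DependsOn κ S (.cmp i j yes no) := by
  intro a b hab
  have := hab i hi j hj
  simp only [result, cost, this, (h1 a b hab).1, (h1 a b hab).2, (h2 a b hab).1, (h2 a b hab).2,
    and_self]

lemma dependsOn_relabel {S : Set ι'} {f : ι → ι'} (hf : ∀ i, f i ∈ S) (t : CompTree ι β) :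
    DependsOn κ S (t.relabel f) := by
  intro a b hab
  have h : ∀ i j, (a ∘ f) i < (a ∘ f) j ↔ (b ∘ f) i < (b ∘ f) j :=
    fun i j => hab _ (hf i) _ (hf j)
  simp [result_congr _ _ h, cost_congr _ _ h]

end CompTree

open CompTree

/-! ### Sorting pieces and merging -/

section Merging

variable {ι κ : Type} [LinearOrder κ]

lemma sortList_perm {X : Sorter} (hX : ∀ n, (X n).Sorts) (a : ι → κ) (l : List ι) :
    ((sortList X l).result a).Perm l := by
  have h := ((hX l.length) κ (a ∘ l.get)).1.map l.get
  simpa [sortList] using h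

lemma sortList_sorted {X : Sorter} (hX : ∀ n, (X n).Sorts) (a : ι → κ) (l : List ι) :
    (((sortList X l).result a).map a).Pairwise (· ≤ ·) := by
  have h := ((hX l.length) κ (a ∘ l.get)).2
  simpa [sortList, List.map_map] using h

lemma sortList_dependsOn (X : Sorter) (l : List ι) :
    DependsOn κ {i | i ∈ l} (sortList X l) :=
  (dependsOn_relabel (S := {i | i ∈ l}) (f := l.get) (fun _ => List.get_mem _ _) _).bind
    fun _ => dependsOn_pure _ _

lemma merge_perm (a : ι → κ) (xs ys : List ι) :
    ((merge xs ys).result a).Perm (xs ++ ys) := by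
  induction xs, ys using merge.induct with
  | case1 ys => simp [merge]
  | case2 x xs => simp [merge]
  | case3 x xs y ys h1 h2 =>
    rw [merge]
    simp only [result]
    split_ifs
    · simpa using h1
    · simpa using (h2.cons y).trans (List.perm_middle (l₁ := x :: xs)).symm

lemma merge_sorted (a : ι → κ) (xs ys : List ι) (hx : (xs.map a).Pairwise (· ≤ ·))
    (hy : (ys.map a).Pairwise (· ≤ ·)) : (((merge xs ys).result a).map a).Pairwise (· ≤ ·) := by
  induction xs, ys using merge.induct with
  | case1 ys => simpa [merge] using hy
  | case2 x xs => simpa [merge] using hx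
  | case3 x xs y ys h1 h2 =>
    rw [merge]
    simp only [result]
    have hx' := hx
    have hy' := hy
    simp only [List.map_cons, List.pairwise_cons, List.mem_map, forall_exists_index, and_imp,
      forall_apply_eq_imp_iff₂] at hx hy
    split_ifs with h
    · simp only [result_bind, result_pure, List.map_cons, List.pairwise_cons, List.mem_map,
        forall_exists_index, and_imp, forall_apply_eq_imp_iff₂]
      refine ⟨fun z hz => ?_, h1 hx.2 hy'⟩
      rcases List.mem_append.1 ((merge_perm a _ _).mem_iff.1 hz) with hz | hz
      · exact hx.1 z hz
      · rcases List.mem_cons.1 hz with rfl | hz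
        · exact h.le
        · exact h.le.trans (hy.1 z hz)
    · simp only [result_bind, result_pure, List.map_cons, List.pairwise_cons, List.mem_map,
        forall_exists_index, and_imp, forall_apply_eq_imp_iff₂]
      refine ⟨fun z hz => ?_, h2 hx' hy.2⟩
      rcases List.mem_append.1 ((merge_perm a _ _).mem_iff.1 hz) with hz | hz
      · rcases List.mem_cons.1 hz with rfl | hz
        · exact not_lt.1 h
        · exact (not_lt.1 h).trans (hx.1 z hz)
      · exact hy.1 z hz

lemma merge_cost_le (a : ι → κ) (xs ys : List ι) :
    (merge xs ys).cost a ≤ xs.length + ys.length := by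
  induction xs, ys using merge.induct with
  | case1 ys => simp [merge]
  | case2 x xs => simp [merge]
  | case3 x xs y ys h1 h2 =>
    rw [merge]
    simp only [cost]
    split_ifs <;> simp at h1 h2 ⊢ <;> omega

lemma merge_dependsOn (S : Set ι) (xs ys : List ι) (hx : ∀ x ∈ xs, x ∈ S) (hy : ∀ y ∈ ys, y ∈ S) :
    DependsOn κ S (merge xs ys) := by
  induction xs, ys using merge.induct with
  | case1 ys => simpa [merge] using dependsOn_pure _ _
  | case2 x xs => simpa [merge] using dependsOn_pure _ _
  | case3 x xs y ys h1 h2 =>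
    rw [merge]
    have hx' := List.forall_mem_cons.1 hx
    have hy' := List.forall_mem_cons.1 hy
    exact .cmp hx'.1 hy'.1 ((h1 hx'.2 hy).bind fun _ => dependsOn_pure _ _)
      ((h2 hx hy'.2).bind fun _ => dependsOn_pure _ _)

lemma mergeXsort_spec {X : Sorter} (hX : ∀ n, (X n).Sorts) (callX : ℕ → ℕ → Bool) (a : ι → κ)
    (d : ℕ) (l : List ι) :
    ((mergeXsort X callX d l).result a).Perm l ∧
      (((mergeXsort X callX d l).result a).map a).Pairwise (· ≤ ·) := by
  induction d, l using mergeXsort.induct callX with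
  | case1 d l h =>
    rw [mergeXsort, if_pos h]
    exact ⟨sortList_perm hX a l, sortList_sorted hX a l⟩
  | case2 d l h h1 h2 =>
    rw [mergeXsort, if_neg h]
    simp only [result_bind]
    refine ⟨(merge_perm a _ _).trans ?_, merge_sorted a _ _ h2.2 h1.2⟩
    simpa using h2.1.append h1.1

/-- As the result is a rearrangement of `l`, merging does not access other elements either. -/
lemma mergeXsort_dependsOn {X : Sorter} (hX : ∀ n, (X n).Sorts) (callX : ℕ → ℕ → Bool)
    (d : ℕ) (l : List ι) : DependsOn κ {i | i ∈ l} (mergeXsort X callX d l) := by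
  induction d, l using mergeXsort.induct callX with
  | case1 d l h =>
    rw [mergeXsort, if_pos h]
    exact sortList_dependsOn X l
  | case2 d l h h1 h2 =>
    rw [mergeXsort, if_neg h]
    refine (h1.mono fun i hi => List.mem_of_mem_drop hi).bind fun a =>
      (h2.mono fun i hi => List.mem_of_mem_take hi).bind fun b => merge_dependsOn _ _ _ ?_ ?_
    · exact fun x hx => List.mem_of_mem_take ((mergeXsort_spec hX callX b _ _).1.mem_iff.1 hx)
    · exact fun x hx => List.mem_of_mem_drop ((mergeXsort_spec hX callX a _ _).1.mem_iff.1 hx)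

end Merging

/-! ### Partitioning -/

section Partitioning

variable {ι κ : Type} [LinearOrder κ]

lemma splitRest_result (a : ι → κ) (S : Split ι) (ys : List ι) :
    (splitRest S ys).result a =
      { less := S.less ++ ys.filter fun y => a y < a S.pivot
        pivot := S.pivot
        greater := S.greater ++ ys.filter fun y => !decide (a y < a S.pivot) } := by
  induction ys generalizing S with
  | nil => simp [splitRest]
  | cons y ys ih =>
    simp only [splitRest, result]
    by_cases h : a y < a S.pivot
    · simp [h, ih]
    · simp only [h, if_false, ih, List.filter_cons, decide_false, Bool.not_false]
      simp

lemma splitRest_cost (a : ι → κ) (S : Split ι) (ys : List ι) :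
    (splitRest S ys).cost a = ys.length := by
  induction ys generalizing S with
  | nil => simp [splitRest]
  | cons y ys ih =>
    simp only [splitRest, cost, ih]
    simp

lemma splitRest_dependsOn {T : Set ι} (S : Split ι) (ys : List ι) (hS : S.pivot ∈ T)
    (hy : ∀ y ∈ ys, y ∈ T) : DependsOn κ T (splitRest S ys) := by
  induction ys generalizing S with
  | nil => simpa [splitRest] using dependsOn_pure _ _
  | cons y ys ih =>
    have hy' := List.forall_mem_cons.1 hy
    simp only [splitRest]
    exact .cmp hy'.1 hS (ih _ hS hy'.2) (ih _ hS hy'.2)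

lemma splitSample_dependsOn (sel : MedianFinder) (x : ι) (xs : List ι) :
    DependsOn κ {i | i ∈ x :: xs} (splitSample sel x xs) :=
  (dependsOn_relabel (S := {i | i ∈ x :: xs}) (f := (x :: xs).get) (fun _ => List.get_mem _ _)
    _).bind fun _ => dependsOn_pure _ _

lemma splitSample_spec {sel : MedianFinder} (hsel : ∀ m, (sel m).FindsMedian) (a : ι → κ)
    (x : ι) (xs : List ι) :
    let S := (splitSample sel x xs).result a
    (S.less ++ S.pivot :: S.greater).Perm (x :: xs) ∧
      (∀ y ∈ S.less, a y ≤ a S.pivot) ∧ (∀ y ∈ S.greater, a S.pivot ≤ a y) ∧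
      S.less.length = xs.length / 2 := by
  have hs := hsel xs.length κ (a ∘ (x :: xs).get)
  simp only [splitSample, result_bind, result_pure, result_relabel]
  set r := (sel xs.length).result (a ∘ (x :: xs).get) with hr
  obtain ⟨h1, h2, h3⟩ := hs
  have hn := List.nodup_finRange (xs.length + 1)
  refine ⟨?_, ?_, ?_, ?_⟩
  · have hp : ((List.finRange (xs.length + 1)).filter
        (fun i => decide (i ≠ r.1) && r.2 i) ++ r.1 ::
        (List.finRange (xs.length + 1)).filter
        (fun i => decide (i ≠ r.1) && !r.2 i)).Perm (List.finRange (xs.length + 1)) := by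
      rw [List.perm_ext_iff_of_nodup _ hn]
      · intro i
        by_cases hi : i = r.1 <;> cases hb : r.2 i <;> simp [hi, hb]
      · rw [List.nodup_append', List.nodup_cons]
        refine ⟨hn.filter _, ⟨by simp, hn.filter _⟩, fun i hi hi' => ?_⟩
        simp only [List.mem_filter, List.mem_cons, Bool.and_eq_true, decide_eq_true_eq,
          Bool.not_eq_true'] at hi hi'
        rcases hi' with rfl | hi'
        · exact hi.2.1 rfl
        · simp [hi.2.2] at hi'
    have hq := hp.map (x :: xs).get
    rwa [show (List.finRange (xs.length + 1)).map (x :: xs).get = x :: xs from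
      List.map_get_finRange (x :: xs), List.map_append, List.map_cons] at hq
  · intro y hy
    obtain ⟨i, hi, rfl⟩ := List.mem_map.1 hy
    simp only [List.mem_filter, Bool.and_eq_true, decide_eq_true_eq] at hi
    exact h1 i hi.2.1 hi.2.2
  · intro y hy
    obtain ⟨i, hi, rfl⟩ := List.mem_map.1 hy
    simp only [List.mem_filter, Bool.and_eq_true, decide_eq_true_eq, Bool.not_eq_true'] at hi
    exact h2 i hi.2.1 hi.2.2
  · rw [List.length_map, ← h3, ← List.toFinset_card_of_nodup (hn.filter _)]
    congr 1
    ext i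
    simp

/-- For distinct keys the sides of the sample are determined by the keys, including the order in
which their elements are listed. -/
lemma splitSample_eq_filter {sel : MedianFinder} (hsel : ∀ m, (sel m).FindsMedian) (a : ι → κ)
    (ha : a.Injective) (x : ι) (xs : List ι) (hd : (x :: xs).Nodup) :
    let S := (splitSample sel x xs).result a
    S.less = (x :: xs).filter (fun y => a y < a S.pivot) ∧
      S.greater = (x :: xs).filter (fun y => a S.pivot < a y) := by
  have hs := hsel xs.length κ (a ∘ (x :: xs).get)
  simp only [splitSample, result_bind, result_pure, result_relabel]
  set r := (sel xs.length).result (a ∘ (x :: xs).get) with hr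
  obtain ⟨h1, h2, -⟩ := hs
  have hinj : ∀ i, i ≠ r.1 → a ((x :: xs).get i) ≠ a ((x :: xs).get r.1) := fun i hi h =>
    hi (List.nodup_iff_injective_get.1 hd (ha h))
  have hfr : ∀ p : ι → Bool, (x :: xs).filter p =
      ((List.finRange (xs.length + 1)).filter (p ∘ (x :: xs).get)).map (x :: xs).get := by
    intro p
    rw [← List.filter_map]
    congr 1
    exact (List.map_get_finRange (x :: xs)).symm
  rw [hfr, hfr]
  refine ⟨congrArg (List.map _) (List.filter_congr fun i _ => ?_),
    congrArg (List.map _) (List.filter_congr fun i _ => ?_)⟩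
  · by_cases hi : i = r.1
    · subst hi; simp
    · cases hb : r.2 i with
      | true => simpa [hi] using (h1 i hi hb).lt_of_ne (hinj i hi)
      | false => simpa [hi] using h2 i hi hb
  · by_cases hi : i = r.1
    · subst hi; simp
    · cases hb : r.2 i with
      | true => simpa [hi] using h1 i hi hb
      | false => simpa [hi] using (h2 i hi hb).lt_of_ne (hinj i hi).symm

lemma splitSample_pivot_mem (sel : MedianFinder) (a : ι → κ) (x : ι) (xs : List ι) :
    ((splitSample sel x xs).result a).pivot ∈ x :: xs := by
  simp only [splitSample, result_bind, result_pure]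
  exact List.get_mem _ _

lemma partition_result (sel : MedianFinder) (k : ℕ) (a : ι → κ) (x : ι) (xs : List ι) :
    (partition sel k x xs).result a =
      (splitRest ((splitSample sel x (xs.take (k - 1))).result a) (xs.drop (k - 1))).result a := by
  simp [partition]

lemma partition_dependsOn (sel : MedianFinder) (k : ℕ) (x : ι) (xs : List ι) :
    DependsOn κ {i | i ∈ x :: xs} (partition sel k x xs) := by
  have h : ∀ y ∈ x :: xs.take (k - 1), y ∈ x :: xs :=
    fun y hy => (List.take_sublist (k - 1) xs).cons_cons x |>.subset hy
  refine ((splitSample_dependsOn sel x _).mono h).bind fun a => splitRest_dependsOn _ _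
    (h _ (splitSample_pivot_mem ..)) fun y hy => ?_
  exact List.mem_cons_of_mem _ (List.mem_of_mem_drop hy)

lemma partition_cost (sel : MedianFinder) (k : ℕ) (a : ι → κ) (x : ι) (xs : List ι) :
    (partition sel k x xs).cost a =
      ((sel (xs.take (k - 1)).length).relabel (x :: xs.take (k - 1)).get).cost a +
        (xs.drop (k - 1)).length := by
  simp [partition, splitSample, splitRest_cost]

lemma partition_spec {sel : MedianFinder} (hsel : ∀ m, (sel m).FindsMedian) (k : ℕ) (a : ι → κ)
    (x : ι) (xs : List ι) :
    let S := (partition sel k x xs).result a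
    (S.less ++ S.pivot :: S.greater).Perm (x :: xs) ∧
      (∀ y ∈ S.less, a y ≤ a S.pivot) ∧ (∀ y ∈ S.greater, a S.pivot ≤ a y) := by
  obtain ⟨h1, h2, h3, -⟩ := splitSample_spec hsel a x (xs.take (k - 1))
  simp only [partition_result, splitRest_result]
  set S := (splitSample sel x (xs.take (k - 1))).result a
  refine ⟨?_, fun y hy => ?_, fun y hy => ?_⟩
  · have hw := List.filter_append_perm (fun y => decide (a y < a S.pivot)) (xs.drop (k - 1))
    have hfin := h1.append hw
    rw [List.cons_append, List.take_append_drop] at hfin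
    refine List.Perm.trans ?_ hfin
    rw [List.append_assoc, List.append_assoc]
    refine List.Perm.append_left _ ?_
    rw [← List.append_assoc, List.cons_append]
    refine (List.perm_middle).trans (List.Perm.cons _ ?_)
    rw [← List.append_assoc]
    exact List.perm_append_comm.append_right _
  · rcases List.mem_append.1 hy with hy | hy
    · exact h2 y hy
    · exact (by simpa using (List.mem_filter.1 hy).2 : a y < a S.pivot).le
  · rcases List.mem_append.1 hy with hy | hy
    · exact h3 y hy
    · simpa using (List.mem_filter.1 hy).2

/-- For distinct keys, the outcome of partitioning a duplicate-free list is determined by the pivot: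
the sides consist of the smaller and of the larger elements, in the order of the list. The pivot is
an element of the sample with the right number of smaller elements in the sample. -/
lemma partition_eq_filter {sel : MedianFinder} (hsel : ∀ m, (sel m).FindsMedian) (k : ℕ)
    (a : ι → κ) (ha : a.Injective) (x : ι) (xs : List ι) (hd : (x :: xs).Nodup) :
    let S := (partition sel k x xs).result a
    S.less = (x :: xs).filter (fun y => a y < a S.pivot) ∧
      S.greater = (x :: xs).filter (fun y => a S.pivot < a y) ∧
      S.pivot ∈ x :: xs.take (k - 1) ∧
      ((x :: xs.take (k - 1)).filter (fun y => a y < a S.pivot)).length =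
        (xs.take (k - 1)).length / 2 := by
  have hsub : (x :: xs.take (k - 1)).Sublist (x :: xs) := (List.take_sublist (k - 1) xs).cons_cons x
  obtain ⟨h1, h2⟩ := splitSample_eq_filter hsel a ha x (xs.take (k - 1)) (hd.sublist hsub)
  have hmem := splitSample_pivot_mem sel a x (xs.take (k - 1))
  have hlen := (splitSample_spec hsel a x (xs.take (k - 1))).2.2.2
  simp only [partition_result, splitRest_result]
  set S := (splitSample sel x (xs.take (k - 1))).result a
  have hspl : x :: xs = (x :: xs.take (k - 1)) ++ xs.drop (k - 1) := by simp
  refine ⟨?_, ?_, hmem, by rw [← h1, hlen]⟩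
  · conv_rhs => rw [hspl]
    rw [List.filter_append, ← h1]
  · conv_rhs => rw [hspl]
    rw [List.filter_append, ← h2]
    congr 1
    refine List.filter_congr fun y hy => ?_
    rw [hspl, List.nodup_append'] at hd
    have hne : a y ≠ a S.pivot := fun h => hd.2.2 hmem (ha h ▸ hy)
    rcases lt_or_gt_of_ne hne with h | h
    · simp [h, h.le]
    · simp [h, h.le]

end Partitioning

/-! ### Correctness of the main loop and of CleverQuicksort -/

lemma pairwise_map_append_cons {ι κ : Type} [LinearOrder κ] {a : ι → κ} {p : ι}
    {u v us vs : List ι} (hu : u.Perm us) (hv : v.Perm vs)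
    (hus : (u.map a).Pairwise (· ≤ ·)) (hvs : (v.map a).Pairwise (· ≤ ·))
    (h1 : ∀ y ∈ us, a y ≤ a p) (h2 : ∀ y ∈ vs, a p ≤ a y) :
    ((u ++ p :: v).map a).Pairwise (· ≤ ·) := by
  have h1' : ∀ y ∈ u, a y ≤ a p := fun y hy => h1 y (hu.mem_iff.1 hy)
  have h2' : ∀ y ∈ v, a p ≤ a y := fun y hy => h2 y (hv.mem_iff.1 hy)
  rw [List.map_append, List.map_cons, List.pairwise_append, List.pairwise_cons]
  refine ⟨hus, ⟨?_, hvs⟩, ?_⟩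
  · simpa using h2'
  · intro y hy z hz
    obtain ⟨y, hy', rfl⟩ := List.mem_map.1 hy
    rcases List.mem_cons.1 hz with rfl | hz
    · exact h1' y hy'
    · obtain ⟨z, hz', rfl⟩ := List.mem_map.1 hz
      exact (h1' y hy').trans (h2' z hz')

section Recursion

variable {n : ℕ} {κ : Type} [LinearOrder κ]

lemma DataMovement.mem_pick (D : DataMovement n) {l : List (Fin n)} {i : Fin n} :
    i ∈ D.pick l ↔ i ∈ l := (D.pick_perm l).mem_iff

lemma DataMovement.mem_move (D : DataMovement n) {l : List (Fin n)} {S : Split (Fin n)}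
    {u t : List (Fin n)} {i : Fin n} : i ∈ D.move l S u t ↔ i ∈ t := (D.move_perm l S u t).mem_iff

lemma DataMovement.length_move (D : DataMovement n) (l : List (Fin n)) (S : Split (Fin n))
    (u t : List (Fin n)) : (D.move l S u t).length = t.length := (D.move_perm l S u t).length_eq

/-- What is known about the outcome `S` of partitioning the rearranged subarray `l`. -/
lemma partition_pick_spec {sel : MedianFinder} (hsel : ∀ m, (sel m).FindsMedian) (k : ℕ)
    (a : Fin n → κ) (D : DataMovement n) {l : List (Fin n)} {x : Fin n} {xs : List (Fin n)}
    (hl : D.pick l = x :: xs) :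
    let S := (partition sel k x xs).result a
    (S.less ++ S.pivot :: S.greater).Perm l ∧
      (∀ y ∈ S.less, a y ≤ a S.pivot) ∧ (∀ y ∈ S.greater, a S.pivot ≤ a y) ∧
      S.less.length + S.greater.length + 1 = l.length ∧
      (∀ y ∈ S.less, y ∈ l) ∧ (∀ y ∈ S.greater, y ∈ l) := by
  obtain ⟨h1, h2, h3⟩ := partition_spec hsel k a x xs
  have h4 := h1.trans (hl ▸ D.pick_perm l)
  refine ⟨h4, h2, h3, ?_, fun y hy => h4.mem_iff.1 (by simp [hy]),
    fun y hy => h4.mem_iff.1 (by simp [hy])⟩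
  have := h4.length_eq
  simp at this
  omega

lemma quickMergeXsortAux_spec {sel : MedianFinder} (hsel : ∀ m, (sel m).FindsMedian)
    (sampleSize : ℕ → ℕ) {X : Sorter} (hX : ∀ n, (X n).Sorts) (D : DataMovement n)
    (useLess : ℕ → ℕ → Bool) (callX : ℕ → ℕ → ℕ → Bool) (a : Fin n → κ) (fuel : ℕ)
    (l : List (Fin n)) (hl : l.length ≤ fuel) :
    ((quickMergeXsortAux sel sampleSize X D useLess callX fuel l).result a).Perm l ∧
    (((quickMergeXsortAux sel sampleSize X D useLess callX fuel l).result a).map a).Pairwise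
      (· ≤ ·) := by
  induction fuel generalizing l with
  | zero =>
    have : l = [] := List.length_eq_zero_iff.1 (by omega)
    subst this
    simp [quickMergeXsortAux]
  | succ fuel ih =>
    rw [quickMergeXsortAux]
    split
    · rename_i h
      have := D.pick_perm l
      rw [h] at this
      simp [this.nil_eq.symm]
    · rename_i x xs h
      obtain ⟨h1, h2, h3, h4, -, -⟩ := partition_pick_spec hsel (sampleSize l.length) a D h
      simp only [result_bind]
      set S := (partition sel (sampleSize l.length) x xs).result a
      split_ifs
      · simp only [result_bind, result_pure]
        obtain ⟨p1, p2⟩ := mergeXsort_spec hX (callX S.less.length) a 0 (D.move l S [] S.less)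
        set u := (mergeXsort X (callX S.less.length) 0 (D.move l S [] S.less)).result a
        obtain ⟨q1, q2⟩ := ih (D.move l S u S.greater) (by rw [D.length_move]; omega)
        have p3 := p1.trans (D.move_perm ..)
        have q3 := q1.trans (D.move_perm ..)
        exact ⟨(p3.append (q3.cons _)).trans h1, pairwise_map_append_cons p3 q3 p2 q2 h2 h3⟩
      · simp only [result_bind, result_pure]
        obtain ⟨p1, p2⟩ := mergeXsort_spec hX (callX S.greater.length) a 0
          (D.move l S [] S.greater)
        set u := (mergeXsort X (callX S.greater.length) 0 (D.move l S [] S.greater)).result a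
        obtain ⟨q1, q2⟩ := ih (D.move l S u S.less) (by rw [D.length_move]; omega)
        have p3 := p1.trans (D.move_perm ..)
        have q3 := q1.trans (D.move_perm ..)
        exact ⟨(q3.append (p3.cons _)).trans h1, pairwise_map_append_cons q3 p3 q2 p2 h2 h3⟩

lemma quickMergeXsortAux_dependsOn {sel : MedianFinder} (hsel : ∀ m, (sel m).FindsMedian)
    (sampleSize : ℕ → ℕ) {X : Sorter} (hX : ∀ n, (X n).Sorts) (D : DataMovement n)
    (useLess : ℕ → ℕ → Bool) (callX : ℕ → ℕ → ℕ → Bool) (fuel : ℕ) (l : List (Fin n)) :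
    DependsOn κ {i | i ∈ l} (quickMergeXsortAux sel sampleSize X D useLess callX fuel l) := by
  induction fuel generalizing l with
  | zero => exact dependsOn_pure _ _
  | succ fuel ih =>
    rw [quickMergeXsortAux]
    split
    · exact dependsOn_pure _ _
    · rename_i x xs h
      refine ((partition_dependsOn sel _ x xs).mono fun i hi => ?_).bind fun a => ?_
      · exact D.mem_pick.1 (h ▸ hi)
      obtain ⟨-, -, -, -, h1, h2⟩ := partition_pick_spec hsel (sampleSize l.length) a D h
      set S := (partition sel (sampleSize l.length) x xs).result a
      split_ifs
      · exact ((mergeXsort_dependsOn hX _ _ _).mono fun i hi => h1 i (D.mem_move.1 hi)).bind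
          fun b => ((ih _).mono fun i hi => h2 i (D.mem_move.1 hi)).bind fun _ =>
            dependsOn_pure _ _
      · exact ((mergeXsort_dependsOn hX _ _ _).mono fun i hi => h2 i (D.mem_move.1 hi)).bind
          fun b => ((ih _).mono fun i hi => h1 i (D.mem_move.1 hi)).bind fun _ =>
            dependsOn_pure _ _

lemma quickMergeXsort_sorts {sel : MedianFinder} (hsel : ∀ m, (sel m).FindsMedian)
    (sampleSize : ℕ → ℕ) {X : Sorter} (hX : ∀ n, (X n).Sorts) (D : DataMovement n)
    (useLess : ℕ → ℕ → Bool) (callX : ℕ → ℕ → ℕ → Bool) :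
    (quickMergeXsort sel sampleSize X n D useLess callX).Sorts := fun _ _ a =>
  quickMergeXsortAux_spec hsel sampleSize hX D useLess callX a n _ (by simp)

lemma cleverQuicksortAux_spec {sel : MedianFinder} (hsel : ∀ m, (sel m).FindsMedian)
    (D : DataMovement n) (a : Fin n → κ) (fuel : ℕ) (l : List (Fin n)) (hl : l.length ≤ fuel) :
    ((cleverQuicksortAux sel D fuel l).result a).Perm l ∧
    (((cleverQuicksortAux sel D fuel l).result a).map a).Pairwise (· ≤ ·) := by
  induction fuel generalizing l with
  | zero =>
    have : l = [] := List.length_eq_zero_iff.1 (by omega)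
    subst this
    simp [cleverQuicksortAux]
  | succ fuel ih =>
    rw [cleverQuicksortAux]
    split
    · rename_i h
      have := D.pick_perm l
      rw [h] at this
      simp [this.nil_eq.symm]
    · rename_i x xs h
      obtain ⟨h1, h2, h3, h4, -, -⟩ := partition_pick_spec hsel 3 a D h
      simp only [result_bind, result_pure]
      set S := (partition sel 3 x xs).result a
      obtain ⟨p1, p2⟩ := ih (D.move l S [] S.less) (by rw [D.length_move]; omega)
      obtain ⟨q1, q2⟩ := ih (D.move l S [] S.greater) (by rw [D.length_move]; omega)
      have p3 := p1.trans (D.move_perm ..)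
      have q3 := q1.trans (D.move_perm ..)
      exact ⟨(p3.append (q3.cons _)).trans h1, pairwise_map_append_cons p3 q3 p2 q2 h2 h3⟩

lemma cleverQuicksortAux_dependsOn {sel : MedianFinder} (hsel : ∀ m, (sel m).FindsMedian)
    (D : DataMovement n) (fuel : ℕ) (l : List (Fin n)) :
    DependsOn κ {i | i ∈ l} (cleverQuicksortAux sel D fuel l) := by
  induction fuel generalizing l with
  | zero => exact dependsOn_pure _ _
  | succ fuel ih =>
    rw [cleverQuicksortAux]
    split
    · exact dependsOn_pure _ _
    · rename_i x xs h
      refine ((partition_dependsOn sel _ x xs).mono fun i hi => ?_).bind fun a => ?_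
      · exact D.mem_pick.1 (h ▸ hi)
      obtain ⟨-, -, -, -, h1, h2⟩ := partition_pick_spec hsel 3 a D h
      exact ((ih _).mono fun i hi => h1 i (D.mem_move.1 hi)).bind fun _ =>
        ((ih _).mono fun i hi => h2 i (D.mem_move.1 hi)).bind fun _ => dependsOn_pure _ _

lemma cleverQuicksort_sorts {sel : MedianFinder} (hsel : ∀ m, (sel m).FindsMedian)
    (D : ∀ n, DataMovement n) (n : ℕ) : (cleverQuicksort sel D n).Sorts := fun _ _ a =>
  cleverQuicksortAux_spec hsel (D n) a n _ (by simp)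

end Recursion

/-! ### Conditional uniformity of relative orders -/

section Resampling

variable {n s : ℕ}

/-- The relative order of the elements `f i` under the keys `π` is the one of a permutation. -/
lemma exists_perm_lt_iff (π : Equiv.Perm (Fin n)) (f : Fin s ↪ Fin n) :
    ∃ σ : Equiv.Perm (Fin s), ∀ i j, π (f i) < π (f j) ↔ σ i < σ j := by
  have hinj : Function.Injective (fun i => π (f i)) := π.injective.comp f.injective
  have hcard : (Finset.univ.image fun i => π (f i)).card = s := by
    rw [Finset.card_image_of_injective _ hinj]; simp
  let e := (Finset.univ.image fun i => π (f i)).orderIsoOfFin hcard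
  let σ : Fin s → Fin s := fun i => e.symm ⟨π (f i), by simp⟩
  have hσ : Function.Injective σ := fun i j h => by
    have := e.symm.injective h
    exact hinj (by simpa using this)
  refine ⟨Equiv.ofBijective σ (Finite.injective_iff_bijective.1 hσ), fun i j => ?_⟩
  simp [σ]

/-- If an event `Ev` is invariant under permuting the keys of the elements `f i` among themselves,
then, conditional on `Ev`, all relative orders of these elements are equally likely. -/
lemma sum_order_pattern (f : Fin s ↪ Fin n) (h : (Fin s → Fin s → Prop) → ℝ)
    (Ev : Finset (Equiv.Perm (Fin n)))
    (hEv : ∀ π ∈ Ev, ∀ τ : Equiv.Perm (Fin n), (∀ i ∉ Set.range f, τ i = i) → π * τ ∈ Ev) :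
    (s.factorial : ℝ) * ∑ π ∈ Ev, h (fun i j => π (f i) < π (f j)) =
      Ev.card * ∑ σ : Equiv.Perm (Fin s), h (fun i j => σ i < σ j) := by
  have key : ∀ τ : Equiv.Perm (Fin s), ∑ π ∈ Ev, h (fun i j => π (f i) < π (f j)) =
      ∑ π ∈ Ev, h (fun i j => π (f (τ i)) < π (f (τ j))) := by
    intro τ
    refine Finset.sum_bij' (fun π _ => π * (τ.viaEmbedding f)⁻¹)
      (fun π _ => π * τ.viaEmbedding f) ?_ ?_ ?_ ?_ ?_
    · intro π hπ
      refine hEv π hπ _ fun i hi => ?_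
      rw [Equiv.Perm.inv_eq_iff_eq, Equiv.Perm.viaEmbedding_apply_of_notMem _ _ _ hi]
    · intro π hπ
      exact hEv π hπ _ fun i hi => Equiv.Perm.viaEmbedding_apply_of_notMem _ _ _ hi
    · intro π _; simp
    · intro π _; simp
    · intro π _
      simp [← Equiv.Perm.viaEmbedding_apply]
  have hsum : (s.factorial : ℝ) * ∑ π ∈ Ev, h (fun i j => π (f i) < π (f j)) =
      ∑ τ : Equiv.Perm (Fin s), ∑ π ∈ Ev, h (fun i j => π (f (τ i)) < π (f (τ j))) := by
    rw [Finset.sum_congr rfl fun τ _ => (key τ).symm, Finset.sum_const, Finset.card_univ,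
      Fintype.card_perm, Fintype.card_fin, nsmul_eq_mul]
  rw [hsum, Finset.sum_comm, ← nsmul_eq_mul, ← Finset.sum_const]
  refine Finset.sum_congr rfl fun π _ => ?_
  obtain ⟨σ, hσ⟩ := exists_perm_lt_iff π f
  simp only [hσ]
  exact Fintype.sum_equiv (Equiv.mulLeft σ) _ _ fun τ => by simp

lemma sum_perm_order_pattern (f : Fin s ↪ Fin n) (h : (Fin s → Fin s → Prop) → ℝ) :
    (s.factorial : ℝ) * ∑ π : Equiv.Perm (Fin n), h (fun i j => π (f i) < π (f j)) =
      n.factorial * ∑ σ : Equiv.Perm (Fin s), h (fun i j => σ i < σ j) := by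
  have := sum_order_pattern f h Finset.univ (fun _ _ _ _ => Finset.mem_univ _)
  rwa [Finset.card_univ, Fintype.card_perm, Fintype.card_fin] at this

variable {β : Type}

lemma avgCost_nonneg (t : CompTree (Fin n) β) : 0 ≤ t.avgCost := by
  unfold avgCost; positivity

lemma sum_cost_eq (t : CompTree (Fin n) β) :
    ∑ π : Equiv.Perm (Fin n), (t.cost π : ℝ) = n.factorial * t.avgCost := by
  unfold avgCost
  field_simp

/-- Average costs do not change when a program is applied to some of the elements of a larger set
of elements. -/
lemma avgCost_relabel (f : Fin s ↪ Fin n) (t : CompTree (Fin s) β) :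
    (t.relabel f).avgCost = t.avgCost := by
  classical
  let key : Equiv.Perm (Fin s) → ℝ := fun σ => t.cost σ
  let pat : Equiv.Perm (Fin s) → Fin s → Fin s → Prop := fun σ i j => σ i < σ j
  have hf : Function.FactorsThrough key pat := fun σ σ' hh => by
    refine congrArg Nat.cast (cost_congr _ _ (fun i j => ?_) t)
    exact iff_of_eq (congrFun (congrFun hh i) j)
  let h : (Fin s → Fin s → Prop) → ℝ := Function.extend pat key 0
  have hσ : ∀ σ, h (pat σ) = key σ := fun σ => hf.extend_apply 0 σ
  have h1 := sum_perm_order_pattern f h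
  have h2 : ∀ π : Equiv.Perm (Fin n),
      h (fun i j => π (f i) < π (f j)) = ((t.relabel f).cost π : ℝ) := by
    intro π
    obtain ⟨σ, hs⟩ := exists_perm_lt_iff π f
    have : (fun i j => π (f i) < π (f j)) = pat σ := by
      funext i j; exact propext (hs i j)
    rw [this, hσ, cost_relabel]
    exact congrArg Nat.cast (cost_congr _ _ (fun i j => (hs i j).symm) t)
  rw [Finset.sum_congr rfl fun π _ => h2 π, Finset.sum_congr rfl fun σ _ => hσ σ] at h1
  rw [sum_cost_eq, show ∑ σ, key σ = s.factorial * t.avgCost from sum_cost_eq t] at h1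
  have p1 : (s.factorial : ℝ) ≠ 0 := by positivity
  have p2 : (n.factorial : ℝ) ≠ 0 := by positivity
  rw [← mul_right_inj' p1, ← mul_right_inj' p2]
  linarith

lemma avgCost_relabel_get {l : List (Fin n)} (hl : l.Nodup) (t : CompTree (Fin l.length) β) :
    (t.relabel l.get).avgCost = t.avgCost :=
  avgCost_relabel ⟨l.get, List.nodup_iff_injective_get.1 hl⟩ t

/-- Conditional on an event that is invariant under permuting the keys of the elements of `l` among
themselves, the average cost of a program that depends only on the elements of `l` is the
unconditional one. -/
lemma sum_cost_of_invariant {l : List (Fin n)} (hl : l.Nodup) {t : CompTree (Fin n) β}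
    (ht : DependsOn (Fin n) {i | i ∈ l} t) (Ev : Finset (Equiv.Perm (Fin n)))
    (hEv : ∀ π ∈ Ev, ∀ τ : Equiv.Perm (Fin n), (∀ i ∉ l, τ i = i) → π * τ ∈ Ev) :
    ∑ π ∈ Ev, (t.cost π : ℝ) = Ev.card * t.avgCost := by
  classical
  let f : Fin l.length ↪ Fin n := ⟨l.get, List.nodup_iff_injective_get.1 hl⟩
  have hrange : ∀ i, i ∈ Set.range f ↔ i ∈ l := fun i => by
    simp [f, List.mem_iff_get]
  let key : Equiv.Perm (Fin n) → ℝ := fun π => t.cost π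
  let pat : Equiv.Perm (Fin n) → Fin l.length → Fin l.length → Prop :=
    fun π i j => π (f i) < π (f j)
  have hf : Function.FactorsThrough key pat := fun π π' hh => by
    refine congrArg Nat.cast (ht _ _ fun i hi j hj => ?_).2
    obtain ⟨i, rfl⟩ := (hrange i).2 hi
    obtain ⟨j, rfl⟩ := (hrange j).2 hj
    exact iff_of_eq (congrFun (congrFun hh i) j)
  let h : (Fin l.length → Fin l.length → Prop) → ℝ := Function.extend pat key 0
  have hσ : ∀ π, h (pat π) = key π := fun π => hf.extend_apply 0 π
  have h1 := sum_order_pattern f h Ev (fun π hπ τ hτ => hEv π hπ τ fun i hi =>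
    hτ i fun h => hi ((hrange i).1 h))
  have h2 := sum_perm_order_pattern f h
  rw [Finset.sum_congr rfl fun π _ => hσ π] at h1 h2
  rw [show ∑ π, key π = n.factorial * t.avgCost from sum_cost_eq t] at h2
  have p1 : (l.length.factorial : ℝ) ≠ 0 := by positivity
  have p2 : (n.factorial : ℝ) ≠ 0 := by positivity
  rw [← mul_right_inj' p1, ← mul_right_inj' p2]
  change _ * (_ * ∑ π ∈ Ev, key π) = _
  rw [h1]
  linear_combination (-(Ev.card : ℝ)) * h2

/-- A program `F π` that is chosen depending on the keys `π`, but that depends only on elements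
whose relative order had no influence on this choice, has the average cost of the unconditional
programs. -/
lemma sum_cost_of_choice (T : Equiv.Perm (Fin n) → List (Fin n))
    (F : Equiv.Perm (Fin n) → CompTree (Fin n) β)
    (hT : ∀ π, (T π).Nodup) (hF : ∀ π, DependsOn (Fin n) {i | i ∈ T π} (F π))
    (hinv : ∀ π τ : Equiv.Perm (Fin n), (∀ i ∉ T π, τ i = i) → T (π * τ) = T π ∧ F (π * τ) = F π) :
    ∑ π, ((F π).cost π : ℝ) = ∑ π, (F π).avgCost := by
  classical
  have hself : ∀ π, ∃ a, T a = T π ∧ F a = F π := fun π => ⟨π, rfl, rfl⟩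
  rw [← Finset.sum_fiberwise_of_maps_to (s := Finset.univ)
    (t := Finset.univ.image fun π => (T π, F π)) (g := fun π => (T π, F π)) (by simp [hself]),
    ← Finset.sum_fiberwise_of_maps_to (s := Finset.univ)
    (t := Finset.univ.image fun π => (T π, F π)) (g := fun π => (T π, F π)) (by simp [hself])]
  refine Finset.sum_congr rfl fun z hz => ?_
  obtain ⟨ρ, -, rfl⟩ := Finset.mem_image.1 hz
  have hmem : ∀ π, π ∈ Finset.univ.filter (fun π => (T π, F π) = (T ρ, F ρ)) ↔
      T π = T ρ ∧ F π = F ρ := by simp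
  rw [Finset.sum_congr rfl fun π hπ => by rw [((hmem π).1 hπ).2],
    sum_cost_of_invariant (hT ρ) (hF ρ), ← nsmul_eq_mul, ← Finset.sum_const]
  · exact Finset.sum_congr rfl fun π hπ => by rw [((hmem π).1 hπ).2]
  · intro π hπ τ hτ
    obtain ⟨h1, h2⟩ := (hmem π).1 hπ
    obtain ⟨h3, h4⟩ := hinv π τ (h1 ▸ hτ)
    exact (hmem _).2 ⟨h3.trans h1, h4.trans h2⟩

end Resampling

/-! ### The information-theoretic lower bound -/

section LowerBound

variable {n : ℕ} {β : Type}

/-- Kraft's inequality for comparison programs. -/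
lemma kraft (t : CompTree (Fin n) β) (A : Finset (Equiv.Perm (Fin n)))
    (hA : Set.InjOn (fun π : Equiv.Perm (Fin n) => t.result π) A) :
    ∑ π ∈ A, ((1 : ℝ) / 2) ^ t.cost π ≤ 1 := by
  induction t generalizing A with
  | ret b =>
    have : A.card ≤ 1 := Finset.card_le_one.2 fun π hπ π' hπ' => hA hπ hπ' rfl
    simpa [cost] using this
  | cmp i j yes no h1 h2 =>
    have e1 := h1 (A.filter fun π => π i < π j) fun π hπ π' hπ' h => by
      simp only [Finset.coe_filter, Set.mem_ofPred_eq] at hπ hπ'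
      refine hA hπ.1 hπ'.1 ?_
      simpa [result, hπ.2, hπ'.2] using h
    have e2 := h2 (A.filter fun π => ¬ π i < π j) fun π hπ π' hπ' h => by
      simp only [Finset.coe_filter, Set.mem_ofPred_eq] at hπ hπ'
      refine hA hπ.1 hπ'.1 ?_
      simpa only [result, if_neg hπ.2, if_neg hπ'.2] using h
    rw [← Finset.sum_filter_add_sum_filter_not A fun π => π i < π j]
    have f1 : ∑ π ∈ A with π i < π j, ((1 : ℝ) / 2) ^ (cmp i j yes no).cost π =
        (1 / 2) * ∑ π ∈ A with π i < π j, ((1 : ℝ) / 2) ^ yes.cost π := by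
      rw [Finset.mul_sum]
      refine Finset.sum_congr rfl fun π hπ => ?_
      rw [cost, if_pos (Finset.mem_filter.1 hπ).2, pow_succ, mul_comm]
    have f2 : ∑ π ∈ A with ¬ π i < π j, ((1 : ℝ) / 2) ^ (cmp i j yes no).cost π =
        (1 / 2) * ∑ π ∈ A with ¬ π i < π j, ((1 : ℝ) / 2) ^ no.cost π := by
      rw [Finset.mul_sum]
      refine Finset.sum_congr rfl fun π hπ => ?_
      rw [cost, if_neg (Finset.mem_filter.1 hπ).2, pow_succ, mul_comm]
    rw [f1, f2]
    linarith

lemma CompTree.Sorts.result_injective {t : CompTree (Fin n) (List (Fin n))} (ht : t.Sorts) :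
    Function.Injective fun π : Equiv.Perm (Fin n) => t.result π := by
  have key : ∀ π : Equiv.Perm (Fin n), (t.result π).map π = List.finRange n := by
    intro π
    obtain ⟨h1, h2⟩ := ht (Fin n) π
    refine List.Perm.eq_of_pairwise' (r := (· ≤ ·)) h2
      ((List.pairwise_lt_finRange n).imp le_of_lt) ?_
    · refine (h1.map π).trans ?_
      rw [List.perm_ext_iff_of_nodup ((List.nodup_finRange n).map π.injective)
        (List.nodup_finRange n)]
      simp [π.surjective _]
  intro π π' h
  have h1 := key π
  have h2 := key π'
  simp only at h
  rw [← h2, h] at h1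
  ext i
  rw [List.map_inj_left.1 h1 i ((ht (Fin n) π').1.mem_iff.2 (List.mem_finRange i))]

/-- The information-theoretic lower bound. -/
lemma CompTree.Sorts.logb_factorial_le {t : CompTree (Fin n) (List (Fin n))} (ht : t.Sorts) :
    Real.logb 2 n.factorial ≤ t.avgCost := by
  have hk := kraft t Finset.univ ht.result_injective.injOn
  have hN : (0 : ℝ) < n.factorial := by positivity
  set L := Real.logb 2 n.factorial
  have hL : (2 : ℝ) ^ L = n.factorial := Real.rpow_logb (by norm_num) (by norm_num) hN
  have hlog2 : 0 < Real.log 2 := Real.log_pos (by norm_num)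
  -- the tangent of `x ↦ 2 ^ x` at `0`
  have htan : ∀ π : Equiv.Perm (Fin n),
      1 + Real.log 2 * (L - t.cost π) ≤ n.factorial * ((1 : ℝ) / 2) ^ t.cost π := by
    intro π
    have : (n.factorial : ℝ) * ((1 : ℝ) / 2) ^ t.cost π =
        Real.exp (Real.log 2 * (L - t.cost π)) := by
      rw [← Real.rpow_def_of_pos (by norm_num), Real.rpow_sub (by norm_num), hL,
        Real.rpow_natCast]
      field_simp
      rw [← mul_pow]; norm_num
    rw [this, add_comm]
    exact Real.add_one_le_exp _
  have hs := Finset.sum_le_sum fun π (_ : π ∈ Finset.univ) => htan π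
  rw [← Finset.mul_sum, Finset.sum_add_distrib, ← Finset.mul_sum, Finset.sum_sub_distrib,
    sum_cost_eq] at hs
  simp only [Finset.sum_const, Finset.card_univ, Fintype.card_perm, Fintype.card_fin,
    nsmul_eq_mul] at hs
  have h3 : Real.log 2 * (n.factorial * (L - t.avgCost)) ≤ 0 := by nlinarith
  have h4 := nonpos_of_mul_nonpos_right h3 hlog2
  linarith [nonpos_of_mul_nonpos_right h4 hN]

/-- The leading constant of a sorting algorithm is at least `1`. -/
lemma one_le_of_avgCost_le {X : Sorter} (hX : ∀ n, (X n).Sorts) {α c : ℝ}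
    (h : ∀ᶠ n : ℕ in atTop, (X n).avgCost ≤ α * ((n : ℝ) * Real.logb 2 n) + c * n) : 1 ≤ α := by
  by_contra hα
  push Not at hα
  have hlog2 : 0 < Real.log 2 := Real.log_pos (by norm_num)
  have hlim : Tendsto (fun n : ℕ => (1 - α) * Real.logb 2 n) atTop atTop :=
    ((Real.tendsto_logb_atTop (by norm_num)).comp tendsto_natCast_atTop_atTop).const_mul_atTop
      (by linarith)
  obtain ⟨n, h1, h2, h3⟩ := (h.and ((hlim.eventually_gt_atTop
    (c + 1 / Real.log 2)).and (eventually_gt_atTop 0))).exists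
  have hn : (0 : ℝ) < n := by exact_mod_cast h3
  have h4 := (hX n).logb_factorial_le
  have h5 : (n : ℝ) * Real.logb 2 n - n / Real.log 2 ≤ Real.logb 2 n.factorial := by
    have hst : (n : ℝ) * Real.log n - n ≤ Real.log n.factorial := by
      have h7 := Stirling.le_log_factorial_stirling h3.ne'
      have h8 : 0 ≤ Real.log n := Real.log_natCast_nonneg n
      have h9 : 0 ≤ Real.log (2 * Real.pi) := Real.log_nonneg (by linarith [Real.pi_gt_three])
      linarith
    unfold Real.logb
    rw [mul_div_assoc', ← sub_div]
    exact div_le_div_of_nonneg_right hst hlog2.le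
  have h6 := mul_lt_mul_of_pos_left h2 hn
  have : (n : ℝ) * (c + 1 / Real.log 2) = c * n + n / Real.log 2 := by ring
  rw [this] at h6
  nlinarith

end LowerBound

/-! ### Average cost of Mergesort with a recursion stopper -/

/-- A bound for large `n` holds for all `n` if the coefficient of the linear term is enlarged. At
`n = 0`, where the linear term vanishes, it has to be assumed. -/
lemma exists_forall_le_add_mul {f g : ℕ → ℝ} {c : ℝ} (hf : f 0 ≤ 0) (hg : ∀ n, 0 ≤ g n)
    (h : ∀ᶠ n : ℕ in atTop, f n ≤ g n + c * n) :
    ∃ C : ℝ, 0 ≤ C ∧ ∀ n, f n ≤ g n + C * n := by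
  obtain ⟨N, hN⟩ := eventually_atTop.1 h
  refine ⟨|c| + ∑ i ∈ Finset.range N, |f i|, by positivity, fun n => ?_⟩
  have hsum : 0 ≤ ∑ i ∈ Finset.range N, |f i| := by positivity
  rcases Nat.eq_zero_or_pos n with rfl | hn
  · simpa using hf.trans (hg 0)
  have hn' : (1 : ℝ) ≤ n := by exact_mod_cast hn
  rcases le_or_gt N n with h1 | h1
  · have h2 : c * n ≤ |c| * n := mul_le_mul_of_nonneg_right (le_abs_self c) (by positivity)
    nlinarith [hN n h1]
  · have h2 : |f n| ≤ ∑ i ∈ Finset.range N, |f i| :=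
      Finset.single_le_sum (f := fun i => |f i|) (fun _ _ => abs_nonneg _) (Finset.mem_range.2 h1)
    have h3 := le_abs_self (f n)
    nlinarith [hg n, abs_nonneg c]

lemma avgCost_zero {β : Type} (t : CompTree (Fin 0) β) : t.avgCost = 0 := by
  cases t with
  | ret b => simp [avgCost, cost]
  | cmp i _ _ _ => exact i.elim0

lemma avgCost_le {n : ℕ} {β : Type} {t : CompTree (Fin n) β} {b : ℝ}
    (h : ∑ π : Equiv.Perm (Fin n), (t.cost π : ℝ) ≤ n.factorial * b) : t.avgCost ≤ b := by
  rw [sum_cost_eq] at h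
  exact le_of_mul_le_mul_left h (by positivity)

lemma logb_le_clog (s : ℕ) : Real.logb 2 s ≤ Nat.clog 2 s := by
  rcases Nat.eq_zero_or_pos s with rfl | hs
  · simp
  rw [Real.logb_le_iff_le_rpow (by norm_num) (by exact_mod_cast hs), Real.rpow_natCast]
  exact_mod_cast Nat.le_pow_clog (by norm_num) s

lemma clog_le_logb_add_one {s : ℕ} (hs : 0 < s) : (Nat.clog 2 s : ℝ) ≤ Real.logb 2 s + 1 := by
  rcases Nat.lt_or_ge 1 s with h | h
  · have h1 := Nat.pow_pred_clog_lt_self (b := 2) (by norm_num) h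
    have h2 : 0 < Nat.clog 2 s := Nat.clog_pos (by norm_num) h
    have h3 : (2 : ℝ) ^ ((Nat.clog 2 s - 1 : ℕ) : ℝ) ≤ s := by
      rw [Real.rpow_natCast]; exact_mod_cast h1.le
    rw [← Real.le_logb_iff_rpow_le (by norm_num) (by exact_mod_cast hs), Nat.cast_pred h2] at h3
    linarith
  · have : s = 1 := by omega
    subst this; simp

/-- Mergesort which hands only pieces of at most `N` elements to `X`. As `⌈s / 2⌉` has a rounded
logarithm that is smaller by one than the one of `s`, the estimate is preserved by merging. -/
lemma mergeXsort_avgCost_le {X : Sorter} (hX : ∀ n, (X n).Sorts) {α C : ℝ} (hα : 1 ≤ α)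
    (hcost : ∀ n, (X n).avgCost ≤ α * (n * Real.logb 2 n) + C * n) {N : ℕ} (hN : 0 < N)
    (callX : ℕ → ℕ → Bool) (hcall : ∀ d s, callX d s = true → s ≤ N) {n : ℕ} (d : ℕ)
    (l : List (Fin n)) (hl : l.Nodup) :
    (mergeXsort X callX d l).avgCost ≤
      l.length * (Nat.clog 2 l.length + ((α - 1) * Real.logb 2 N + C)) := by
  have hlogN : 0 ≤ Real.logb 2 N := Real.logb_nonneg (by norm_num) (by exact_mod_cast hN)
  induction d, l using mergeXsort.induct callX with
  | case1 d l h =>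
    rw [mergeXsort, if_pos h]
    have hcost' : (sortList X l).avgCost = (X l.length).avgCost := by
      rw [← avgCost_relabel_get hl]
      simp [avgCost, sortList]
    rw [hcost']
    refine (hcost l.length).trans ?_
    have hle : Real.logb 2 l.length ≤ Real.logb 2 N := by
      rcases Nat.eq_zero_or_pos l.length with h0 | h0
      · simpa [h0] using hlogN
      · refine Real.logb_le_logb_of_le (by norm_num) (by exact_mod_cast h0) ?_
        rcases h with h | h
        · exact_mod_cast h.trans hN
        · exact_mod_cast hcall d _ h
    have h1 := mul_le_mul_of_nonneg_left hle (sub_nonneg.2 hα)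
    have h2 := logb_le_clog l.length
    have h3 : α * Real.logb 2 l.length + C ≤
        Nat.clog 2 l.length + ((α - 1) * Real.logb 2 N + C) := by linarith
    have := mul_le_mul_of_nonneg_left h3 (Nat.cast_nonneg (α := ℝ) l.length)
    linarith
  | case2 d l h h1 h2 =>
    have h3 := h1 (hl.sublist (List.drop_sublist _ _))
    have h4 := h2 (hl.sublist (List.take_sublist _ _))
    rw [mergeXsort, if_neg h]
    push Not at h
    set B := (α - 1) * Real.logb 2 N + C
    rw [List.length_drop] at h3
    rw [List.length_take, min_eq_left (by omega)] at h4
    refine avgCost_le ?_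
    have h5 : ∀ π : Equiv.Perm (Fin n), ((mergeXsort X callX (d + 1) (l.drop (l.length / 2)) >>=
        fun second => mergeXsort X callX (d + 1) (l.take (l.length / 2)) >>= fun first =>
          merge first second).cost π : ℝ) ≤
        (mergeXsort X callX (d + 1) (l.drop (l.length / 2))).cost π +
        (mergeXsort X callX (d + 1) (l.take (l.length / 2))).cost π + l.length := by
      intro π
      have e1 := merge_cost_le π
        ((mergeXsort X callX (d + 1) (l.take (l.length / 2))).result π)
        ((mergeXsort X callX (d + 1) (l.drop (l.length / 2))).result π)
      rw [(mergeXsort_spec hX callX π _ _).1.length_eq,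
        (mergeXsort_spec hX callX π _ _).1.length_eq, List.length_take, List.length_drop] at e1
      simp only [cost_bind]
      exact_mod_cast (by omega)
    refine (Finset.sum_le_sum fun π _ => h5 π).trans ?_
    rw [Finset.sum_add_distrib, Finset.sum_add_distrib, sum_cost_eq, sum_cost_eq]
    simp only [Finset.sum_const, Finset.card_univ, Fintype.card_perm, Fintype.card_fin,
      nsmul_eq_mul]
    rw [← mul_add, ← mul_add]
    refine mul_le_mul_of_nonneg_left ?_ (by positivity)
    set s := l.length with hs
    have h6 : Nat.clog 2 s = Nat.clog 2 ((s + 1) / 2) + 1 := by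
      rw [Nat.clog_of_two_le (by norm_num) (by omega)]; rfl
    have h7 : Nat.clog 2 (s - s / 2) = Nat.clog 2 ((s + 1) / 2) := by congr 1; omega
    have h8 : Nat.clog 2 (s / 2) ≤ Nat.clog 2 ((s + 1) / 2) := Nat.clog_mono_right _ (by omega)
    have h8' : (Nat.clog 2 (s / 2) : ℝ) ≤ Nat.clog 2 ((s + 1) / 2) := by exact_mod_cast h8
    rw [h7, Nat.cast_sub (by omega)] at h3
    rw [h6, Nat.cast_succ]
    have h9 := mul_le_mul_of_nonneg_left h8' (Nat.cast_nonneg (α := ℝ) (s / 2))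
    linarith

/-! ### The rank of the pivot -/

section Rank

variable {n : ℕ}

/-- The number of elements of `A` whose key precedes the one of `x` with respect to `r`. -/
def rank (r : Fin n → Fin n → Prop) [DecidableRel r] (A : Finset (Fin n))
    (π : Equiv.Perm (Fin n)) (x : Fin n) : ℕ :=
  (A.filter fun y => r (π y) (π x)).card

variable (r : Fin n → Fin n → Prop) [DecidableRel r] {A : Finset (Fin n)}

lemma rank_mul {τ : Equiv.Perm (Fin n)} (hτ : ∀ y, τ y ∈ A ↔ y ∈ A) (π : Equiv.Perm (Fin n))
    (x : Fin n) : rank r A (π * τ) x = rank r A π (τ x) := by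
  refine Finset.card_bij (fun y _ => τ y) ?_ ?_ ?_
  · intro y hy
    rw [Finset.mem_filter] at hy ⊢
    exact ⟨(hτ y).2 hy.1, hy.2⟩
  · intro y _ z _ h
    exact τ.injective h
  · intro y hy
    refine ⟨τ.symm y, ?_, by simp⟩
    have := hτ (τ.symm y)
    simp only [Equiv.apply_symm_apply] at this
    rw [Finset.mem_filter] at hy ⊢
    simpa [← this] using hy

lemma swap_mem_iff {x y : Fin n} (hx : x ∈ A) (hy : y ∈ A) (z : Fin n) :
    Equiv.swap x y z ∈ A ↔ z ∈ A := by
  rcases eq_or_ne z x with rfl | h1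
  · simp [hx, hy]
  rcases eq_or_ne z y with rfl | h2
  · simp [hx, hy]
  rw [Equiv.swap_apply_of_ne_of_ne h1 h2]

variable [IsStrictTotalOrder (Fin n) r]

lemma rank_lt_rank {π : Equiv.Perm (Fin n)} {x y : Fin n} (hx : x ∈ A) (h : r (π x) (π y)) :
    rank r A π x < rank r A π y := by
  refine Finset.card_lt_card ⟨fun z hz => ?_, fun hh => ?_⟩
  · rw [Finset.mem_filter] at hz ⊢
    exact ⟨hz.1, _root_.trans hz.2 h⟩
  · have := hh (Finset.mem_filter.2 ⟨hx, h⟩)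
    exact irrefl (r := r) _ (Finset.mem_filter.1 this).2

lemma rank_injOn (A : Finset (Fin n)) (π : Equiv.Perm (Fin n)) :
    Set.InjOn (rank r A π) A := by
  intro x hx y hy h
  by_contra hne
  rcases trichotomous_of r (π x) (π y) with h1 | h1 | h1
  · exact (rank_lt_rank r hx h1).ne h
  · exact hne (π.injective h1)
  · exact (rank_lt_rank r hy h1).ne' h

lemma rank_lt_card {π : Equiv.Perm (Fin n)} {x : Fin n} (hx : x ∈ A) : rank r A π x < A.card := by
  refine Finset.card_lt_card ⟨Finset.filter_subset _ _, fun hh => ?_⟩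
  exact irrefl (r := r) _ (Finset.mem_filter.1 (hh hx)).2

lemma image_rank (A : Finset (Fin n)) (π : Equiv.Perm (Fin n)) :
    A.image (rank r A π) = Finset.range A.card := by
  refine Finset.eq_of_subset_of_card_le (fun k hk => ?_) ?_
  · obtain ⟨x, hx, rfl⟩ := Finset.mem_image.1 hk
    exact Finset.mem_range.2 (rank_lt_card r hx)
  · rw [Finset.card_image_of_injOn (rank_injOn r A π), Finset.card_range]

lemma sum_rank (A : Finset (Fin n)) (π : Equiv.Perm (Fin n)) (Φ : ℕ → ℝ) :
    ∑ x ∈ A, Φ (rank r A π x) = ∑ k ∈ Finset.range A.card, Φ k := by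
  rw [← image_rank r A π, Finset.sum_image (rank_injOn r A π)]

/-- By symmetry, all elements of `A` are equally likely to have a small rank. -/
lemma card_mul_card_rank_lt_le {x : Fin n} (hx : x ∈ A) (q : ℕ) :
    A.card * (Finset.univ.filter fun π : Equiv.Perm (Fin n) => rank r A π x < q).card ≤
      n.factorial * q := by
  have hsymm : ∀ y ∈ A, (Finset.univ.filter fun π : Equiv.Perm (Fin n) => rank r A π y < q).card =
      (Finset.univ.filter fun π : Equiv.Perm (Fin n) => rank r A π x < q).card := by
    intro y hy
    refine Finset.card_bij' (fun π _ => π * Equiv.swap x y) (fun π _ => π * Equiv.swap x y)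
      ?_ ?_ ?_ ?_
    · intro π hπ
      simpa [rank_mul r (swap_mem_iff hx hy)] using hπ
    · intro π hπ
      simpa [rank_mul r (swap_mem_iff hx hy)] using hπ
    · intro π _; simp [mul_assoc]
    · intro π _; simp [mul_assoc]
  calc A.card * (Finset.univ.filter fun π : Equiv.Perm (Fin n) => rank r A π x < q).card
      = ∑ y ∈ A, (Finset.univ.filter fun π : Equiv.Perm (Fin n) => rank r A π y < q).card := by
        rw [Finset.sum_congr rfl hsymm, Finset.sum_const, smul_eq_mul]
    _ = ∑ π : Equiv.Perm (Fin n), (A.filter fun y => rank r A π y < q).card :=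
        Finset.sum_card_bipartiteAbove_eq_sum_card_bipartiteBelow (fun y π => rank r A π y < q)
    _ ≤ ∑ π : Equiv.Perm (Fin n), q := by
        refine Finset.sum_le_sum fun π _ => ?_
        conv_rhs => rw [← Finset.card_range q]
        refine Finset.card_le_card_of_injOn (rank r A π) (fun y hy => ?_)
          ((rank_injOn r A π).mono (Finset.coe_subset.2 (Finset.filter_subset _ _)))
        simpa using (Finset.mem_filter.1 hy).2
    _ = n.factorial * q := by
        rw [Finset.sum_const, Finset.card_univ, Fintype.card_perm, Fintype.card_fin, smul_eq_mul]

/-- Suppose that at least half of the sample `B` is at or below the pivot `P π`. If the rank of the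
pivot is smaller than `q`, so are the ranks of half of the sample; Markov's inequality bounds the
probability by `2 q / |A|`. -/
lemma card_mul_card_rank_pivot_lt_le {B : Finset (Fin n)} (hB : B ⊆ A) (hB0 : B.Nonempty)
    (P : Equiv.Perm (Fin n) → Fin n)
    (hP : ∀ π, B.card ≤ 2 * (B.filter fun y => y = P π ∨ r (π y) (π (P π))).card) (q : ℕ) :
    A.card * (Finset.univ.filter fun π : Equiv.Perm (Fin n) => rank r A π (P π) < q).card ≤
      2 * (n.factorial * q) := by
  have h1 : (Finset.univ.filter fun π : Equiv.Perm (Fin n) => rank r A π (P π) < q).card *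
      B.card ≤ 2 * ∑ π : Equiv.Perm (Fin n), (B.filter fun y => rank r A π y < q).card := by
    rw [← smul_eq_mul, ← Finset.sum_const, Finset.mul_sum]
    refine (Finset.sum_le_sum fun π hπ => ?_).trans
      (Finset.sum_le_sum_of_subset (Finset.subset_univ
        (Finset.univ.filter fun π : Equiv.Perm (Fin n) => rank r A π (P π) < q)))
    refine (hP π).trans (Nat.mul_le_mul_left 2 (Finset.card_le_card fun y hy => ?_))
    rw [Finset.mem_filter] at hy hπ ⊢
    refine ⟨hy.1, ?_⟩
    rcases hy.2 with h | h
    · rw [h]; exact hπ.2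
    · exact (rank_lt_rank r (hB hy.1) h).trans hπ.2
  have h2 : A.card * ∑ π : Equiv.Perm (Fin n), (B.filter fun y => rank r A π y < q).card ≤
      B.card * (n.factorial * q) := by
    have h := Finset.sum_card_bipartiteAbove_eq_sum_card_bipartiteBelow (s := B)
      (t := Finset.univ) (fun y (π : Equiv.Perm (Fin n)) => rank r A π y < q)
    simp only [Finset.bipartiteAbove, Finset.bipartiteBelow] at h
    rw [← h, Finset.mul_sum, ← smul_eq_mul (a := B.card), ← Finset.sum_const]
    exact Finset.sum_le_sum fun y hy => card_mul_card_rank_lt_le r (hB hy) q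
  have h3 := Nat.mul_le_mul_left A.card h1
  refine Nat.le_of_mul_le_mul_right ?_ hB0.card_pos
  nlinarith

end Rank

section PivotRank

variable {n : ℕ} {A : Finset (Fin n)}

lemma rank_lt_add_rank_gt {π : Equiv.Perm (Fin n)} {x : Fin n} (hx : x ∈ A) :
    rank (· < ·) A π x + rank (· > ·) A π x + 1 = A.card := by
  unfold rank
  rw [← Finset.card_union_of_disjoint, ← Finset.card_erase_add_one hx]
  · congr 2
    ext y
    have : y ≠ x ↔ π y < π x ∨ π x < π y := by
      rw [lt_or_lt_iff_ne, π.injective.ne_iff]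
    simp only [Finset.mem_union, Finset.mem_filter, Finset.mem_erase, this]
    tauto
  · rw [Finset.disjoint_left]
    intro y hy hy'
    exact lt_asymm (Finset.mem_filter.1 hy).2 (Finset.mem_filter.1 hy').2

/-- The larger side contains on average at most a `15 / 16` fraction of the elements, for samples of
any size. -/
lemma sum_max_rank_le {B : Finset (Fin n)} (hB : B ⊆ A)
    (P : Equiv.Perm (Fin n) → Fin n) (hPB : ∀ π, P π ∈ B)
    (hP1 : ∀ π, B.card ≤ 2 * (B.filter fun y => y = P π ∨ π y < π (P π)).card)
    (hP2 : ∀ π, B.card ≤ 2 * (B.filter fun y => y = P π ∨ π y > π (P π)).card) :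
    ∑ π : Equiv.Perm (Fin n),
        ((max (rank (· < ·) A π (P π)) (rank (· > ·) A π (P π)) : ℕ) : ℝ) ≤
      n.factorial * (15 / 16 * A.card) := by
  have hB0 : B.Nonempty := ⟨_, hPB 1⟩
  -- with probability at least `1 / 2` both sides have at least `q` elements
  set q := A.card / 8 with hq
  set b1 := (Finset.univ.filter fun π : Equiv.Perm (Fin n) => rank (· < ·) A π (P π) < q).card
  set b2 := (Finset.univ.filter fun π : Equiv.Perm (Fin n) => rank (· > ·) A π (P π) < q).card
  have h1 : A.card * b1 ≤ 2 * (n.factorial * q) :=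
    card_mul_card_rank_pivot_lt_le (· < ·) hB hB0 P hP1 q
  have h2 : A.card * b2 ≤ 2 * (n.factorial * q) :=
    card_mul_card_rank_pivot_lt_le (· > ·) hB hB0 P hP2 q
  have hpt : ∀ π : Equiv.Perm (Fin n),
      ((max (rank (· < ·) A π (P π)) (rank (· > ·) A π (P π)) : ℕ) : ℝ) ≤
      (A.card - 1 - q) + q * ((if rank (· < ·) A π (P π) < q then 1 else 0) +
        (if rank (· > ·) A π (P π) < q then 1 else 0)) := by
    intro π
    have h3 := rank_lt_add_rank_gt (π := π) (hB (hPB π))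
    have h4 : (max (rank (· < ·) A π (P π)) (rank (· > ·) A π (P π))) + 1 + q ≤
      A.card + q * ((if rank (· < ·) A π (P π) < q then 1 else 0) +
        (if rank (· > ·) A π (P π) < q then 1 else 0)) := by
      split_ifs <;> omega
    have h5 : (((max (rank (· < ·) A π (P π)) (rank (· > ·) A π (P π)) : ℕ) : ℝ)) + 1 + q ≤
      A.card + q * ((if rank (· < ·) A π (P π) < q then 1 else 0) +
        (if rank (· > ·) A π (P π) < q then 1 else 0)) := by exact_mod_cast h4
    linarith
  refine (Finset.sum_le_sum fun π _ => hpt π).trans ?_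
  rw [Finset.sum_add_distrib, ← Finset.mul_sum, Finset.sum_add_distrib, Finset.sum_boole,
    Finset.sum_boole, Finset.sum_const, Finset.card_univ, Fintype.card_perm, Fintype.card_fin,
    nsmul_eq_mul]
  change (n.factorial : ℝ) * (A.card - 1 - q) + q * ((b1 : ℝ) + b2) ≤ _
  have hs : (0 : ℝ) < A.card := by exact_mod_cast (hB0.mono hB).card_pos
  have hN : (0 : ℝ) < n.factorial := by positivity
  have h1' : (A.card : ℝ) * b1 ≤ 2 * (n.factorial * q) := by exact_mod_cast h1
  have h2' : (A.card : ℝ) * b2 ≤ 2 * (n.factorial * q) := by exact_mod_cast h2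
  have hq1 : 8 * (q : ℝ) ≤ A.card := by exact_mod_cast (by omega : 8 * q ≤ A.card)
  have hq2 : (A.card : ℝ) ≤ 8 * q + 7 := by exact_mod_cast (by omega : A.card ≤ 8 * q + 7)
  have hb : (b1 : ℝ) + b2 ≤ n.factorial / 2 := by
    refine le_of_mul_le_mul_left ?_ hs
    nlinarith
  have hqb := mul_le_mul_of_nonneg_left hb (Nat.cast_nonneg (α := ℝ) q)
  nlinarith

lemma sum_eq_card_sub_mul {f : Fin n → ℝ} {c : ℝ} {E : Finset (Fin n)} (hE : E ⊆ A)
    (h0 : ∀ x ∈ E, f x = 0) (hc : ∀ x ∈ A, x ∉ E → f x = c) :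
    ∑ x ∈ A, f x = (A.card - E.card) * c := by
  rw [← Finset.sum_sdiff hE, Finset.sum_eq_zero h0, add_zero,
    Finset.sum_congr rfl fun x hx => hc x (Finset.mem_sdiff.1 hx).1 (Finset.mem_sdiff.1 hx).2,
    Finset.sum_const, nsmul_eq_mul, Finset.card_sdiff_of_subset hE,
    Nat.cast_sub (Finset.card_le_card hE)]

lemma sum_perm_apply {τ : Equiv.Perm (Fin n)} (hτ : ∀ y, τ y ∈ A ↔ y ∈ A) (f : Fin n → ℝ) :
    ∑ z ∈ A, f (τ z) = ∑ z ∈ A, f z :=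
  Finset.sum_equiv τ (fun y => (hτ y).symm) fun _ _ => rfl

/-- The distribution of the rank of the median of three elements: the median `x` and the smaller and
the larger element `y` and `z` of the sample take all triples of distinct elements of `A` equally
likely, and `k * (|A| - 1 - k)` pairs `y`, `z` fit to an `x` of rank `k`. The factor `6` counts the
ways in which the three given elements play these roles. -/
lemma sum_rank_median_three_le {x₁ x₂ x₃ : Fin n} (h₁ : x₁ ∈ A) (h₂ : x₂ ∈ A) (h₃ : x₃ ∈ A)
    (h₁₂ : x₁ ≠ x₂) (h₁₃ : x₁ ≠ x₃) (h₂₃ : x₂ ≠ x₃) (Φ : ℕ → ℝ) (hΦ : ∀ k, 0 ≤ Φ k)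
    (P : Equiv.Perm (Fin n) → Fin n)
    (hP : ∀ π, ∃ y ∈ ({x₁, x₂, x₃} : Finset (Fin n)), ∃ z ∈ ({x₁, x₂, x₃} : Finset (Fin n)),
      P π ∈ ({x₁, x₂, x₃} : Finset (Fin n)) ∧ π y < π (P π) ∧ π (P π) < π z) :
    (A.card : ℝ) * (A.card - 1) * (A.card - 2) *
        ∑ π : Equiv.Perm (Fin n), Φ (rank (· < ·) A π (P π)) ≤
      n.factorial * (6 * ∑ k ∈ Finset.range A.card, (k * (A.card - 1 - k)) * Φ k) := by
  set T : Fin n → Fin n → Fin n → ℝ := fun y x z => ∑ π : Equiv.Perm (Fin n),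
    if π y < π x ∧ π x < π z then Φ (rank (· < ·) A π x) else 0 with hT
  have hsymm : ∀ τ : Equiv.Perm (Fin n), (∀ y, τ y ∈ A ↔ y ∈ A) →
      ∀ y x z, T (τ y) (τ x) (τ z) = T y x z := by
    intro τ hτ y x z
    refine Fintype.sum_equiv (Equiv.mulRight τ) _ _ fun π => ?_
    simp [rank_mul _ hτ]
  -- by symmetry, the summation over one of the arguments only contributes a factor
  have hz : ∀ y ∈ A, ∀ x ∈ A, ∀ z ∈ A, x ≠ y → x ≠ z → y ≠ z →
      ∑ z' ∈ A, T y x z' = (A.card - 2) * T y x z := by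
    intro y hy x hx z hz n1 n2 n3
    rw [sum_eq_card_sub_mul (E := {x, y}) (c := T y x z), Finset.card_pair n1, Nat.cast_two]
    · simp [Finset.insert_subset_iff, hx, hy]
    · intro z' hz'
      simp only [Finset.mem_insert, Finset.mem_singleton] at hz'
      refine Finset.sum_eq_zero fun π _ => if_neg fun h => ?_
      rcases hz' with rfl | rfl
      · exact lt_irrefl _ h.2
      · exact lt_asymm h.1 h.2
    · intro z' hz' hne
      simp only [Finset.mem_insert, Finset.mem_singleton, not_or] at hne
      have h := hsymm (Equiv.swap z z') (swap_mem_iff hz hz') y x z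
      rwa [Equiv.swap_apply_left, Equiv.swap_apply_of_ne_of_ne n3 (Ne.symm hne.2),
        Equiv.swap_apply_of_ne_of_ne n2 (Ne.symm hne.1)] at h
  have hy : ∀ y ∈ A, ∀ x ∈ A, x ≠ y →
      ∑ y' ∈ A, ∑ z' ∈ A, T y' x z' = (A.card - 1) * ∑ z' ∈ A, T y x z' := by
    intro y hy x hx n1
    rw [sum_eq_card_sub_mul (E := {x}) (c := ∑ z' ∈ A, T y x z'), Finset.card_singleton,
      Nat.cast_one]
    · simpa using hx
    · intro y' hy'
      rw [Finset.mem_singleton] at hy'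
      exact Finset.sum_eq_zero fun z' _ => Finset.sum_eq_zero fun π _ =>
        if_neg fun h => lt_irrefl _ (hy' ▸ h.1)
    · intro y' hy' hne
      rw [Finset.mem_singleton] at hne
      rw [← sum_perm_apply (swap_mem_iff hy hy')]
      refine Finset.sum_congr rfl fun z' _ => ?_
      have h := hsymm (Equiv.swap y y') (swap_mem_iff hy hy') y x z'
      rwa [Equiv.swap_apply_left, Equiv.swap_apply_of_ne_of_ne n1 (Ne.symm hne)] at h
  have hx : ∀ x ∈ A, ∑ x' ∈ A, ∑ y' ∈ A, ∑ z' ∈ A, T y' x' z' =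
      A.card * ∑ y' ∈ A, ∑ z' ∈ A, T y' x z' := by
    intro x hx
    rw [sum_eq_card_sub_mul (E := ∅) (c := ∑ y' ∈ A, ∑ z' ∈ A, T y' x z') (by simp) (by simp)]
    · simp
    · intro x' hx' _
      rw [← sum_perm_apply (swap_mem_iff hx hx')]
      refine Finset.sum_congr rfl fun y' _ => ?_
      rw [← sum_perm_apply (swap_mem_iff hx hx')]
      refine Finset.sum_congr rfl fun z' _ => ?_
      have h := hsymm (Equiv.swap x x') (swap_mem_iff hx hx') y' x z'
      rwa [Equiv.swap_apply_left] at h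
  have htot : ∑ x' ∈ A, ∑ y' ∈ A, ∑ z' ∈ A, T y' x' z' =
      n.factorial * ∑ k ∈ Finset.range A.card, (k * (A.card - 1 - k)) * Φ k := by
    have h1 : ∀ π : Equiv.Perm (Fin n), ∑ x' ∈ A, ∑ y' ∈ A, ∑ z' ∈ A,
        (if π y' < π x' ∧ π x' < π z' then Φ (rank (· < ·) A π x') else 0) =
        ∑ k ∈ Finset.range A.card, (k * (A.card - 1 - k)) * Φ k := by
      intro π
      rw [← sum_rank (· < ·) A π fun k => ((k : ℝ) * (A.card - 1 - k)) * Φ k]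
      refine Finset.sum_congr rfl fun x hx => ?_
      have h2 : ((rank (· < ·) A π x : ℕ) : ℝ) + (rank (· > ·) A π x : ℕ) + 1 = A.card := by
        exact_mod_cast rank_lt_add_rank_gt hx
      have h3 : (A.card : ℝ) - 1 - rank (· < ·) A π x = rank (· > ·) A π x := by linarith
      rw [h3]
      simp only [ite_and]
      have h4 : ∀ y', ∑ z' ∈ A, (if π y' < π x then
          if π x < π z' then Φ (rank (· < ·) A π x) else 0 else 0) =
          if π y' < π x then rank (· > ·) A π x * Φ (rank (· < ·) A π x) else 0 := by
        intro y'
        split_ifs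
        · rw [← Finset.sum_filter, Finset.sum_const, nsmul_eq_mul]; rfl
        · simp
      simp only [h4]
      rw [← Finset.sum_filter, Finset.sum_const, nsmul_eq_mul, ← mul_assoc]; rfl
    have h5 : ∑ x' ∈ A, ∑ y' ∈ A, ∑ z' ∈ A, T y' x' z' = ∑ π : Equiv.Perm (Fin n),
        ∑ x' ∈ A, ∑ y' ∈ A, ∑ z' ∈ A,
        (if π y' < π x' ∧ π x' < π z' then Φ (rank (· < ·) A π x') else 0) := by
      simp only [hT]
      symm
      rw [Finset.sum_comm]
      refine Finset.sum_congr rfl fun x' _ => ?_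
      rw [Finset.sum_comm]
      refine Finset.sum_congr rfl fun y' _ => ?_
      rw [Finset.sum_comm]
    rw [h5, Finset.sum_congr rfl fun π _ => h1 π, Finset.sum_const, Finset.card_univ,
      Fintype.card_perm, Fintype.card_fin, nsmul_eq_mul]
  have hall : ∀ y ∈ A, ∀ x ∈ A, ∀ z ∈ A, x ≠ y → x ≠ z → y ≠ z →
      (A.card : ℝ) * (A.card - 1) * (A.card - 2) * T y x z =
      n.factorial * ∑ k ∈ Finset.range A.card, (k * (A.card - 1 - k)) * Φ k := by
    intro y hyA x hxA z hzA n1 n2 n3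
    rw [← htot, hx x hxA, hy y hyA x hxA n1, hz y hyA x hxA z hzA n1 n2 n3]
    ring
  have hle : ∑ π : Equiv.Perm (Fin n), Φ (rank (· < ·) A π (P π)) ≤
      T x₁ x₂ x₃ + T x₃ x₂ x₁ + T x₂ x₁ x₃ + T x₃ x₁ x₂ + T x₁ x₃ x₂ + T x₂ x₃ x₁ := by
    simp only [hT, ← Finset.sum_add_distrib]
    refine Finset.sum_le_sum fun π _ => ?_
    have hnn : ∀ y x z, 0 ≤ if π y < π x ∧ π x < π z then Φ (rank (· < ·) A π x) else 0 :=
      fun y x z => by split_ifs; exacts [hΦ _, le_rfl]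
    have e1 := hnn x₁ x₂ x₃
    have e2 := hnn x₃ x₂ x₁
    have e3 := hnn x₂ x₁ x₃
    have e4 := hnn x₃ x₁ x₂
    have e5 := hnn x₁ x₃ x₂
    have e6 := hnn x₂ x₃ x₁
    obtain ⟨y, hy, z, hz, hp, h1, h2⟩ := hP π
    have h3 : (if π y < π (P π) ∧ π (P π) < π z then Φ (rank (· < ·) A π (P π)) else 0) =
      Φ (rank (· < ·) A π (P π)) := if_pos ⟨h1, h2⟩
    simp only [Finset.mem_insert, Finset.mem_singleton] at hy hz hp
    have n1 : y ≠ P π := fun h => h1.ne (congrArg π h)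
    have n2 : z ≠ P π := fun h => h2.ne' (congrArg π h)
    have n3 : y ≠ z := fun h => (h1.trans h2).ne (congrArg π h)
    rw [← h3]
    rcases hp with hp | hp | hp <;> rw [hp] at n1 n2 ⊢ <;> rcases hy with rfl | rfl | rfl <;>
      rcases hz with rfl | rfl | rfl <;>
      first | exact absurd rfl n1 | exact absurd rfl n2 | exact absurd rfl n3 | linarith
  have hcard : (3 : ℝ) ≤ A.card := by
    have : ({x₁, x₂, x₃} : Finset (Fin n)).card ≤ A.card := Finset.card_le_card (by
      simp [Finset.insert_subset_iff, h₁, h₂, h₃])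
    rw [Finset.card_eq_three.2 ⟨x₁, x₂, x₃, h₁₂, h₁₃, h₂₃, rfl⟩] at this
    exact_mod_cast this
  have hD : 0 ≤ (A.card : ℝ) * (A.card - 1) * (A.card - 2) :=
    mul_nonneg (mul_nonneg (by linarith) (by linarith)) (by linarith)
  refine (mul_le_mul_of_nonneg_left hle hD).trans (le_of_eq ?_)
  simp only [mul_add]
  rw [hall _ h₁ _ h₂ _ h₃ h₁₂.symm h₂₃ h₁₃, hall _ h₃ _ h₂ _ h₁ h₂₃ h₁₂.symm h₁₃.symm,
    hall _ h₂ _ h₁ _ h₃ h₁₂ h₁₃ h₂₃, hall _ h₃ _ h₁ _ h₂ h₁₃ h₁₂ h₂₃.symm,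
    hall _ h₁ _ h₃ _ h₂ h₁₃.symm h₂₃.symm h₁₂, hall _ h₂ _ h₃ _ h₁ h₂₃.symm h₁₃.symm h₁₂.symm]
  ring

end PivotRank

/-! ### Partitioning under random keys -/

section PartitionOrder

variable {n : ℕ} {sel : MedianFinder} (hsel : ∀ m, (sel m).FindsMedian) (k : ℕ)
  {x : Fin n} {xs : List (Fin n)} (hd : (x :: xs).Nodup)

lemma card_filter_toFinset {l : List (Fin n)} (hl : l.Nodup) (p : Fin n → Prop) [DecidablePred p] :
    (l.toFinset.filter p).card = (l.filter fun y => p y).length := by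
  rw [← List.toFinset_card_of_nodup (hl.filter _), List.toFinset_filter]
  simp

include hd in
lemma sample_nodup : (x :: xs.take (k - 1)).Nodup :=
  hd.sublist ((List.take_sublist (k - 1) xs).cons_cons x)

include hsel hd

/-- Permuting the keys of the elements of one side among themselves does not change the outcome of
the partitioning. -/
lemma partition_result_mul (π τ : Equiv.Perm (Fin n)) {t : List (Fin n)}
    (ht : t = ((partition sel k x xs).result π).less ∨
      t = ((partition sel k x xs).result π).greater)
    (hτ : ∀ i ∉ t, τ i = i) :
    (partition sel k x xs).result (π * τ) = (partition sel k x xs).result π := by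
  obtain ⟨h1, h2, h3, h4⟩ := partition_eq_filter hsel k π π.injective x xs hd
  obtain ⟨g1, g2, g3, g4⟩ := partition_eq_filter hsel k (π * τ) (π * τ).injective x xs hd
  set S := (partition sel k x xs).result π
  set S' := (partition sel k x xs).result (π * τ)
  have hmem : ∀ y ∈ t, τ y ∈ t := by
    intro y hy
    by_contra h
    have := τ.injective (hτ _ h)
    exact h (this.symm ▸ hy)
  have hp : τ S.pivot = S.pivot := by
    refine hτ _ fun h => ?_
    rcases ht with rfl | rfl
    · rw [h1] at h; simp at h
    · rw [h2] at h; simp at h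
  have hlt : ∀ y, (π * τ) y < (π * τ) S.pivot ↔ π y < π S.pivot := by
    intro y
    rw [Equiv.Perm.mul_apply, Equiv.Perm.mul_apply, hp]
    by_cases hy : y ∈ t
    · have hy' := hmem y hy
      rcases ht with rfl | rfl
      · rw [h1, List.mem_filter] at hy hy'
        simp only [decide_eq_true_eq] at hy hy'
        exact iff_of_true hy'.2 hy.2
      · rw [h2, List.mem_filter] at hy hy'
        simp only [decide_eq_true_eq] at hy hy'
        exact iff_of_false hy'.2.not_gt hy.2.not_gt
    · rw [hτ y hy]
  have hgt : ∀ y, (π * τ) S.pivot < (π * τ) y ↔ π S.pivot < π y := by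
    intro y
    rcases eq_or_ne y S.pivot with rfl | hne
    · simp
    · rw [← not_le, ← not_le, le_iff_lt_or_eq, le_iff_lt_or_eq, hlt]
      simp [hne]
  -- two elements of the sample with the same number of smaller elements are equal
  have hpp : S'.pivot = S.pivot := by
    have hB := sample_nodup k hd
    rw [← card_filter_toFinset hB] at g4
    simp_rw [← hlt] at h4
    rw [← card_filter_toFinset hB, ← g4] at h4
    exact (rank_injOn (· < ·) (x :: xs.take (k - 1)).toFinset (π * τ)
      (List.mem_toFinset.2 h3) (List.mem_toFinset.2 g3) h4).symm
  rw [hpp] at g1 g2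
  simp_rw [hlt] at g1
  simp_rw [hgt] at g2
  rw [← h1] at g1
  rw [← h2] at g2
  cases hS : S
  cases hS' : S'
  simp_all

lemma partition_rank (π : Equiv.Perm (Fin n)) :
    let S := (partition sel k x xs).result π
    S.less.length = rank (· < ·) (x :: xs).toFinset π S.pivot ∧
      S.greater.length = rank (· > ·) (x :: xs).toFinset π S.pivot := by
  obtain ⟨h1, h2, -, -⟩ := partition_eq_filter hsel k π π.injective x xs hd
  intro S
  unfold rank
  rw [card_filter_toFinset hd, card_filter_toFinset hd]
  exact ⟨congrArg List.length h1, congrArg List.length h2⟩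

lemma partition_sample (π : Equiv.Perm (Fin n)) :
    let p := ((partition sel k x xs).result π).pivot
    let B := (x :: xs.take (k - 1)).toFinset
    p ∈ B ∧ B.card = (xs.take (k - 1)).length + 1 ∧
      rank (· < ·) B π p = (xs.take (k - 1)).length / 2 := by
  obtain ⟨-, -, h3, h4⟩ := partition_eq_filter hsel k π π.injective x xs hd
  have hB := sample_nodup k hd
  refine ⟨List.mem_toFinset.2 h3, by rw [List.toFinset_card_of_nodup hB, List.length_cons], ?_⟩
  unfold rank
  rw [card_filter_toFinset hB]
  exact h4

/-- The larger side has on average at most a `15 / 16` fraction of the elements. -/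
lemma sum_max_length_le :
    ∑ π : Equiv.Perm (Fin n), ((max ((partition sel k x xs).result π).less.length
        ((partition sel k x xs).result π).greater.length : ℕ) : ℝ) ≤
      n.factorial * (15 / 16 * (x :: xs).length) := by
  have hcard := List.toFinset_card_of_nodup hd
  rw [← hcard]
  have hB : (x :: xs.take (k - 1)).toFinset ⊆ (x :: xs).toFinset := fun y hy =>
    List.mem_toFinset.2 (((List.take_sublist (k - 1) xs).cons_cons x).subset
      (List.mem_toFinset.1 hy))
  have := sum_max_rank_le hB (fun π => ((partition sel k x xs).result π).pivot)
    (fun π => (partition_sample hsel k hd π).1) ?_ ?_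
  · refine le_trans (le_of_eq (Finset.sum_congr rfl fun π _ => ?_)) this
    rw [(partition_rank hsel k hd π).1, (partition_rank hsel k hd π).2]
  · intro π
    obtain ⟨h1, h2, h3⟩ := partition_sample hsel k hd π
    set p := ((partition sel k x xs).result π).pivot
    have : (Finset.filter (fun y => y = p ∨ π y < π p) (x :: xs.take (k - 1)).toFinset) =
        insert p (Finset.filter (fun y => π y < π p) (x :: xs.take (k - 1)).toFinset) := by
      ext y
      simp only [Finset.mem_filter, Finset.mem_insert]
      constructor
      · tauto
      · rintro (rfl | h)
        exacts [⟨h1, Or.inl rfl⟩, ⟨h.1, Or.inr h.2⟩]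
    rw [this, Finset.card_insert_of_notMem (by simp)]
    simp only [rank] at h3
    omega
  · intro π
    obtain ⟨h1, h2, h3⟩ := partition_sample hsel k hd π
    have h4 := rank_lt_add_rank_gt (π := π) h1
    set p := ((partition sel k x xs).result π).pivot
    have : (Finset.filter (fun y => y = p ∨ π y > π p) (x :: xs.take (k - 1)).toFinset) =
        insert p (Finset.filter (fun y => π y > π p) (x :: xs.take (k - 1)).toFinset) := by
      ext y
      simp only [Finset.mem_filter, Finset.mem_insert]
      constructor
      · tauto
      · rintro (rfl | h)
        exacts [⟨h1, Or.inl rfl⟩, ⟨h.1, Or.inr h.2⟩]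
    rw [this, Finset.card_insert_of_notMem (by simp)]
    simp only [rank] at h3 h4
    omega

omit hsel in
lemma sum_partition_cost :
    ∑ π : Equiv.Perm (Fin n), ((partition sel k x xs).cost π : ℝ) =
      n.factorial * ((sel (xs.take (k - 1)).length).avgCost + (xs.drop (k - 1)).length) := by
  simp only [partition_cost, Nat.cast_add]
  rw [Finset.sum_add_distrib, sum_cost_eq, Finset.sum_const, Finset.card_univ, Fintype.card_perm,
    Fintype.card_fin, nsmul_eq_mul, mul_add]
  congr 2
  exact avgCost_relabel_get (sample_nodup k hd) _

end PartitionOrder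

/-! ### The main loop -/

section MainLoop

variable {sel : MedianFinder} (hsel : ∀ m, (sel m).FindsMedian)

lemma exists_sel_avgCost_le
    (hselCost : (fun m : ℕ => (sel m).avgCost) =O[atTop] fun m : ℕ => (m : ℝ) ^ 2) :
    ∃ C : ℝ, 0 ≤ C ∧ ∀ m, (sel m).avgCost ≤ C * ((m : ℝ) + 1) ^ 2 := by
  obtain ⟨c, hc⟩ := hselCost.bound
  obtain ⟨N, hN⟩ := eventually_atTop.1 hc
  refine ⟨|c| + ∑ i ∈ Finset.range N, (sel i).avgCost,
    add_nonneg (abs_nonneg _) (Finset.sum_nonneg fun _ _ => avgCost_nonneg _), fun m => ?_⟩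
  have hsum : 0 ≤ ∑ i ∈ Finset.range N, (sel i).avgCost :=
    Finset.sum_nonneg fun _ _ => avgCost_nonneg _
  have hm : (0 : ℝ) ≤ m := Nat.cast_nonneg m
  have h1 : (1 : ℝ) ≤ ((m : ℝ) + 1) ^ 2 := by nlinarith
  rcases le_or_gt N m with h | h
  · have h2 := hN m h
    rw [Real.norm_of_nonneg (avgCost_nonneg _), Real.norm_of_nonneg (by positivity)] at h2
    have h3 : c * (m : ℝ) ^ 2 ≤ |c| * ((m : ℝ) + 1) ^ 2 :=
      mul_le_mul (le_abs_self c) (by nlinarith) (by positivity) (abs_nonneg c)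
    nlinarith
  · have h2 : (sel m).avgCost ≤ ∑ i ∈ Finset.range N, (sel i).avgCost :=
      Finset.single_le_sum (f := fun i => (sel i).avgCost) (fun _ _ => avgCost_nonneg _)
        (Finset.mem_range.2 h)
    nlinarith [abs_nonneg c]

include hsel

omit hsel in
lemma quickMergeXsortAux_cost {sampleSize : ℕ → ℕ} {X : Sorter} {n : ℕ} {D : DataMovement n}
    {useLess : ℕ → ℕ → Bool} {callX : ℕ → ℕ → ℕ → Bool} {fuel : ℕ} {l : List (Fin n)} {x : Fin n}
    {xs : List (Fin n)} (hpick : D.pick l = x :: xs) {κ : Type} [LinearOrder κ] (a : Fin n → κ) :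
    let S := (partition sel (sampleSize l.length) x xs).result a
    let c := useLess S.less.length S.greater.length
    let t₁ := if c then S.less else S.greater
    let t₂ := if c then S.greater else S.less
    let M := mergeXsort X (callX t₁.length) 0 (D.move l S [] t₁)
    (quickMergeXsortAux sel sampleSize X D useLess callX (fuel + 1) l).cost a =
      (partition sel (sampleSize l.length) x xs).cost a + (M.cost a +
        (quickMergeXsortAux sel sampleSize X D useLess callX fuel
          (D.move l S (M.result a) t₂)).cost a) := by
  intro S c t₁ t₂ M
  rw [quickMergeXsortAux]
  simp only [hpick, cost_bind]
  congr 1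
  change CompTree.cost a (if c = true then _ else _) = _
  simp only [M, t₁, t₂]
  split_ifs <;> simp [S]

/-- A potential argument: every round costs on average at most `K / 16` comparisons per element for
partitioning, and at least a `1 / 16` fraction of the elements is on average sorted by Mergesort
at a cost of at most `γ` per element. -/
lemma quickMergeXsortAux_avgCost_le (sampleSize : ℕ → ℕ) {X : Sorter} (hX : ∀ n, (X n).Sorts)
    {n : ℕ} (D : DataMovement n) (useLess : ℕ → ℕ → Bool) (callX : ℕ → ℕ → ℕ → Bool)
    {γ K : ℝ} (hγ : 0 ≤ γ) (hK : 0 ≤ K)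
    (hmerge : ∀ m ≤ n, ∀ l : List (Fin n), l.Nodup → l.length = m →
      (mergeXsort X (callX m) 0 l).avgCost ≤ γ * l.length)
    (hpart : ∀ s m j : ℕ, m + j + 1 = s → m + 1 ≤ max 1 (sampleSize s) →
      (sel m).avgCost + j ≤ K / 16 * s)
    (fuel : ℕ) (l : List (Fin n)) (hl : l.Nodup) :
    (quickMergeXsortAux sel sampleSize X D useLess callX fuel l).avgCost ≤
      (γ + K) * l.length := by
  induction fuel generalizing l with
  | zero =>
    have : (quickMergeXsortAux sel sampleSize X D useLess callX 0 l).avgCost = 0 := by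
      simp [quickMergeXsortAux, avgCost]
    rw [this]; positivity
  | succ fuel ih =>
    rcases hpick : D.pick l with _ | ⟨x, xs⟩
    · have : (quickMergeXsortAux sel sampleSize X D useLess callX (fuel + 1) l).avgCost = 0 := by
        rw [quickMergeXsortAux]
        simp [hpick, avgCost]
      rw [this]; positivity
    have hperm := D.pick_perm l
    rw [hpick] at hperm
    have hd : (x :: xs).Nodup := hperm.nodup_iff.2 hl
    have hlen : (x :: xs).length = l.length := hperm.length_eq
    set k := sampleSize l.length with hk
    set S : Equiv.Perm (Fin n) → Split (Fin n) := fun π => (partition sel k x xs).result π with hS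
    have hspec := fun π : Equiv.Perm (Fin n) => partition_pick_spec hsel k π D hpick
    have hSmul := fun π τ t => partition_result_mul hsel k hd π τ (t := t)
    -- the side `T₁` for Mergesort and the remaining side `T₂`
    set c : Equiv.Perm (Fin n) → Bool :=
      fun π => useLess (S π).less.length (S π).greater.length with hc
    set T₁ : Equiv.Perm (Fin n) → List (Fin n) :=
      fun π => if c π then (S π).less else (S π).greater with hT₁
    set T₂ : Equiv.Perm (Fin n) → List (Fin n) :=
      fun π => if c π then (S π).greater else (S π).less with hT₂
    set F₁ : Equiv.Perm (Fin n) → CompTree (Fin n) (List (Fin n)) :=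
      fun π => mergeXsort X (callX (T₁ π).length) 0 (D.move l (S π) [] (T₁ π)) with hF₁
    set F₂ : Equiv.Perm (Fin n) → CompTree (Fin n) (List (Fin n)) :=
      fun π => quickMergeXsortAux sel sampleSize X D useLess callX fuel
        (D.move l (S π) ((F₁ π).result π) (T₂ π)) with hF₂
    have hT₁c : ∀ π, T₁ π = (S π).less ∨ T₁ π = (S π).greater := fun π => by
      simp only [hT₁]; split_ifs <;> simp
    have hT₂c : ∀ π, T₂ π = (S π).less ∨ T₂ π = (S π).greater := fun π => by
      simp only [hT₂]; split_ifs <;> simp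
    have hnodup : ∀ π, ((S π).less ++ (S π).pivot :: (S π).greater).Nodup := fun π =>
      (hspec π).1.nodup_iff.2 hl
    have hT₁d : ∀ π, (T₁ π).Nodup := fun π => by
      have h := hnodup π
      rw [List.nodup_append', List.nodup_cons] at h
      simp only [hT₁]; split_ifs
      exacts [h.1, h.2.1.2]
    have hT₂d : ∀ π, (T₂ π).Nodup := fun π => by
      have h := hnodup π
      rw [List.nodup_append', List.nodup_cons] at h
      simp only [hT₂]; split_ifs
      exacts [h.2.1.2, h.1]
    have hdisj : ∀ π, ∀ i ∈ T₁ π, i ∉ T₂ π := fun π i hi hi' => by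
      have h := hnodup π
      rw [List.nodup_append'] at h
      simp only [hT₁, hT₂] at hi hi'
      split_ifs at hi hi'
      · exact h.2.2 hi (List.mem_cons_of_mem _ hi')
      · exact h.2.2 hi' (List.mem_cons_of_mem _ hi)
    have hsum : ∀ π, (T₁ π).length + (T₂ π).length + 1 = l.length := fun π => by
      have h := (hspec π).2.2.2.1
      change (S π).less.length + (S π).greater.length + 1 = _ at h
      simp only [hT₁, hT₂]; split_ifs <;> omega
    have hmax : ∀ π, (T₂ π).length ≤ max (S π).less.length (S π).greater.length := fun π => by
      simp only [hT₂]; split_ifs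
      exacts [le_max_right _ _, le_max_left _ _]
    refine avgCost_le ?_
    have hcost : ∀ π : Equiv.Perm (Fin n),
        ((quickMergeXsortAux sel sampleSize X D useLess callX (fuel + 1) l).cost π : ℝ) =
        ((partition sel k x xs).cost π : ℝ) + ((F₁ π).cost π + (F₂ π).cost π) := fun π => by
      rw [quickMergeXsortAux_cost hpick]
      push_cast
      rfl
    rw [Finset.sum_congr rfl fun π _ => hcost π, Finset.sum_add_distrib, Finset.sum_add_distrib]
    have hdep₁ : ∀ π, DependsOn (Fin n) {i | i ∈ T₁ π} (F₁ π) := fun π =>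
      (mergeXsort_dependsOn hX _ _ _).mono fun i hi => D.mem_move.1 hi
    have hdep₂ : ∀ π, DependsOn (Fin n) {i | i ∈ T₂ π} (F₂ π) := fun π =>
      (quickMergeXsortAux_dependsOn hsel _ hX _ _ _ _ _).mono fun i hi => D.mem_move.1 hi
    have e1 : ∑ π, ((F₁ π).cost π : ℝ) = ∑ π, (F₁ π).avgCost := by
      refine sum_cost_of_choice T₁ F₁ hT₁d hdep₁ fun π τ hτ => ?_
      have h : S (π * τ) = S π := hSmul π τ _ (hT₁c π) hτ
      simp only [hF₁, hT₁, hc, h, and_self]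
    have e2 : ∑ π, ((F₂ π).cost π : ℝ) = ∑ π, (F₂ π).avgCost := by
      refine sum_cost_of_choice T₂ F₂ hT₂d hdep₂ fun π τ hτ => ?_
      have h : S (π * τ) = S π := hSmul π τ _ (hT₂c π) hτ
      have h1 : F₁ (π * τ) = F₁ π := by simp only [hF₁, hT₁, hc, h]
      -- the other side is sorted in the same way
      have h2 : (F₁ π).result (π * τ) = (F₁ π).result π := by
        refine (hdep₁ π _ _ fun i hi j hj => ?_).1
        rw [Equiv.Perm.mul_apply, Equiv.Perm.mul_apply, hτ i (hdisj π i hi), hτ j (hdisj π j hj)]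
      simp only [hF₂, hT₂, hc, h, h1, h2, and_self]
    rw [e1, e2, sum_partition_cost k hd]
    have b1 : ∀ π, (F₁ π).avgCost ≤ γ * (T₁ π).length := fun π => by
      have h1 : (D.move l (S π) [] (T₁ π)).Nodup := (D.move_perm ..).nodup_iff.2 (hT₁d π)
      have h2 := D.length_move l (S π) [] (T₁ π)
      have h3 : (T₁ π).length ≤ n := by simpa using (hT₁d π).length_le_card
      have := hmerge _ h3 _ h1 h2
      rwa [h2] at this
    have b2 : ∀ π, (F₂ π).avgCost ≤ (γ + K) * (T₂ π).length := fun π => by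
      have h1 : (D.move l (S π) ((F₁ π).result π) (T₂ π)).Nodup :=
        (D.move_perm ..).nodup_iff.2 (hT₂d π)
      have := ih _ h1
      rwa [D.length_move] at this
    have b3 : ∀ π, (F₁ π).avgCost + (F₂ π).avgCost ≤ γ * l.length +
        K * ((max (S π).less.length (S π).greater.length : ℕ) : ℝ) := fun π => by
      have h1 : ((T₁ π).length : ℝ) + (T₂ π).length ≤ l.length := by
        exact_mod_cast (by have := hsum π; omega :
          (T₁ π).length + (T₂ π).length ≤ l.length)
      have h2 : ((T₂ π).length : ℝ) ≤ (max (S π).less.length (S π).greater.length : ℕ) := by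
        exact_mod_cast hmax π
      have h3 := mul_le_mul_of_nonneg_left h1 hγ
      have h4 := mul_le_mul_of_nonneg_left h2 hK
      linarith [b1 π, b2 π]
    have b4 : ∑ π, (F₁ π).avgCost + ∑ π, (F₂ π).avgCost ≤
        n.factorial * (γ * l.length) + K * (n.factorial * (15 / 16 * l.length)) := by
      rw [← Finset.sum_add_distrib]
      refine (Finset.sum_le_sum fun π _ => b3 π).trans ?_
      rw [Finset.sum_add_distrib, Finset.sum_const, ← Finset.mul_sum, Finset.card_univ,
        Fintype.card_perm, Fintype.card_fin, nsmul_eq_mul, ← hlen]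
      exact add_le_add le_rfl
        (mul_le_mul_of_nonneg_left (sum_max_length_le hsel k hd) hK)
    have b5 := hpart l.length (xs.take (k - 1)).length (xs.drop (k - 1)).length
      (by rw [← hlen, List.length_cons, List.length_take, List.length_drop]; omega)
      (by rw [List.length_take]; omega)
    have b6 := mul_le_mul_of_nonneg_left b5 (Nat.cast_nonneg (α := ℝ) n.factorial)
    linarith

end MainLoop

/-! ### CleverQuicksort -/

section CleverQuicksort

lemma sum_mul_harmonic_two (s : ℕ) :
    ∑ k ∈ Finset.range s, (k : ℝ) * (k + 1) * (harmonic k : ℝ) =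
      (s - 1) * s * (s + 1) / 3 * (harmonic s : ℝ) - s * (s - 1) * (2 * s + 5) / 18 := by
  induction s with
  | zero => simp
  | succ s ih =>
    rw [Finset.sum_range_succ, ih, harmonic_succ]
    push_cast
    field_simp
    ring

lemma sum_mul_harmonic_three (s : ℕ) :
    ∑ k ∈ Finset.range s, (k : ℝ) * (k + 1) * (k + 2) * (harmonic k : ℝ) =
      (s - 1) * s * (s + 1) * (s + 2) / 4 * (harmonic s : ℝ) -
        s * (s - 1) * (3 * s ^ 2 + 17 * s + 26) / 48 := by
  induction s with
  | zero => simp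
  | succ s ih =>
    rw [Finset.sum_range_succ, ih, harmonic_succ]
    push_cast
    field_simp
    ring

/-- The function `(k + 1) * H_k`, averaged over the rank `k` of the median of three elements. -/
lemma sum_median_harmonic (s : ℕ) :
    ∑ k ∈ Finset.range s, (k : ℝ) * (s - 1 - k) * ((k + 1) * (harmonic k : ℝ)) =
      s * (s - 1) * (s - 2) / 12 * ((s + 1) * (harmonic s : ℝ) - (7 * s + 19) / 12) := by
  have h : ∀ k ∈ Finset.range s, (k : ℝ) * (s - 1 - k) * ((k + 1) * (harmonic k : ℝ)) =
      (s + 1) * ((k : ℝ) * (k + 1) * (harmonic k : ℝ)) -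
        (k : ℝ) * (k + 1) * (k + 2) * (harmonic k : ℝ) := fun k _ => by ring
  rw [Finset.sum_congr rfl h, Finset.sum_sub_distrib, ← Finset.mul_sum, sum_mul_harmonic_two,
    sum_mul_harmonic_three]
  ring

lemma sum_median (s : ℕ) :
    ∑ k ∈ Finset.range s, (k : ℝ) * (s - 1 - k) = s * (s - 1) * (s - 2) / 6 := by
  have h1 : ∀ t : ℕ, ∑ k ∈ Finset.range t, (k : ℝ) = t * (t - 1) / 2 := fun t => by
    induction t with
    | zero => simp
    | succ t ih => rw [Finset.sum_range_succ, ih]; push_cast; ring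
  have h2 : ∀ t : ℕ, ∑ k ∈ Finset.range t, (k : ℝ) ^ 2 = t * (t - 1) * (2 * t - 1) / 6 :=
    fun t => by
      induction t with
      | zero => simp
      | succ t ih => rw [Finset.sum_range_succ, ih]; push_cast; ring
  have h : ∀ k ∈ Finset.range s, (k : ℝ) * (s - 1 - k) = (s - 1) * k - (k : ℝ) ^ 2 :=
    fun k _ => by ring
  rw [Finset.sum_congr rfl h, Finset.sum_sub_distrib, ← Finset.mul_sum, h1, h2]
  ring

/-- The bound for CleverQuicksort on `s` elements, up to the constant `B` of the linear term. -/
noncomputable def cleverBound (B : ℝ) (s : ℕ) : ℝ :=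
  12 / 7 * ((s + 1) * (harmonic s : ℝ)) + B * s

lemma harmonic_cast_nonneg (s : ℕ) : (0 : ℝ) ≤ (harmonic s : ℝ) := by
  have : (0 : ℚ) ≤ harmonic s := Finset.sum_nonneg fun i _ => by positivity
  exact_mod_cast this

lemma cleverBound_nonneg {B : ℝ} (hB : 0 ≤ B) (s : ℕ) : 0 ≤ cleverBound B s := by
  have := harmonic_cast_nonneg s
  unfold cleverBound
  positivity

lemma sum_median_cleverBound (B : ℝ) (s : ℕ) :
    6 * ∑ k ∈ Finset.range s,
        (k : ℝ) * (s - 1 - k) * (cleverBound B k + cleverBound B (s - 1 - k)) =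
      s * (s - 1) * (s - 2) * (cleverBound B s - s - 19 / 7 - B) := by
  have href : ∑ k ∈ Finset.range s, (k : ℝ) * (s - 1 - k) *
      ((((s - 1 - k : ℕ) : ℝ) + 1) * (harmonic (s - 1 - k) : ℝ)) =
      ∑ k ∈ Finset.range s, (k : ℝ) * (s - 1 - k) * ((k + 1) * (harmonic k : ℝ)) := by
    rw [← Finset.sum_range_reflect]
    refine Finset.sum_congr rfl fun k hk => ?_
    have hk' := Finset.mem_range.1 hk
    have h1 : s - 1 - (s - 1 - k) = k := by omega
    rw [h1, Nat.sub_sub, Nat.cast_sub (by omega)]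
    push_cast
    ring
  have h : ∀ k ∈ Finset.range s,
      (k : ℝ) * (s - 1 - k) * (cleverBound B k + cleverBound B (s - 1 - k)) =
      12 / 7 * ((k : ℝ) * (s - 1 - k) * ((k + 1) * (harmonic k : ℝ))) +
      12 / 7 * ((k : ℝ) * (s - 1 - k) *
        ((((s - 1 - k : ℕ) : ℝ) + 1) * (harmonic (s - 1 - k) : ℝ))) +
      B * (s - 1) * ((k : ℝ) * (s - 1 - k)) := fun k hk => by
    have hk' := Finset.mem_range.1 hk
    have h1 : ((s - 1 - k : ℕ) : ℝ) = s - 1 - k := by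
      rw [Nat.sub_sub, Nat.cast_sub (by omega)]
      push_cast
      ring
    unfold cleverBound
    rw [h1]
    ring
  rw [Finset.sum_congr rfl h, Finset.sum_add_distrib, Finset.sum_add_distrib, ← Finset.mul_sum,
    ← Finset.mul_sum, ← Finset.mul_sum, href, sum_median_harmonic, sum_median]
  unfold cleverBound
  ring

variable {sel : MedianFinder}

lemma cleverQuicksortAux_cost {n : ℕ} {D : DataMovement n} {fuel : ℕ} {l : List (Fin n)}
    {x : Fin n} {xs : List (Fin n)} (hpick : D.pick l = x :: xs) {κ : Type} [LinearOrder κ]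
    (a : Fin n → κ) :
    let S := (partition sel 3 x xs).result a
    (cleverQuicksortAux sel D (fuel + 1) l).cost a = (partition sel 3 x xs).cost a +
      ((cleverQuicksortAux sel D fuel (D.move l S [] S.less)).cost a +
        (cleverQuicksortAux sel D fuel (D.move l S [] S.greater)).cost a) := by
  rw [cleverQuicksortAux]
  simp [hpick]

variable (hsel : ∀ m, (sel m).FindsMedian)

include hsel

/-- The average of the bound over the outcomes of the partitioning. -/
lemma sum_cleverBound_sides_le {c₀ : ℝ} (hc₀ : 0 ≤ c₀) {n : ℕ} {x : Fin n}
    {xs : List (Fin n)} (hd : (x :: xs).Nodup) :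
    ∑ π : Equiv.Perm (Fin n),
      (cleverBound (c₀ + 1) ((partition sel 3 x xs).result π).less.length +
        cleverBound (c₀ + 1) ((partition sel 3 x xs).result π).greater.length) ≤
    n.factorial * (cleverBound (c₀ + 1) (x :: xs).length - (x :: xs).length - c₀) := by
  have hcard := List.toFinset_card_of_nodup hd
  have hB : 0 ≤ c₀ + 1 := by linarith
  have hrank := fun π => partition_rank hsel 3 hd π
  have hsub : (x :: xs.take (3 - 1)).toFinset ⊆ (x :: xs).toFinset := fun y hy =>
    List.mem_toFinset.2 (((List.take_sublist (3 - 1) xs).cons_cons x).subset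
      (List.mem_toFinset.1 hy))
  have hsum : ∀ π : Equiv.Perm (Fin n), ((partition sel 3 x xs).result π).less.length +
      ((partition sel 3 x xs).result π).greater.length + 1 = (x :: xs).length := fun π => by
    rw [(hrank π).1, (hrank π).2, ← hcard]
    exact rank_lt_add_rank_gt (hsub (partition_sample hsel 3 hd π).1)
  have hN : (0 : ℝ) < n.factorial := by positivity
  match xs, hd, hcard, hrank, hsub, hsum with
  | [], hd, hcard, hrank, hsub, hsum =>
    have h : ∀ π : Equiv.Perm (Fin n),
        cleverBound (c₀ + 1) ((partition sel 3 x []).result π).less.length +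
        cleverBound (c₀ + 1) ((partition sel 3 x []).result π).greater.length = 0 := fun π => by
      have := hsum π
      simp only [List.length_cons, List.length_nil] at this
      rw [show ((partition sel 3 x []).result π).less.length = 0 by omega,
        show ((partition sel 3 x []).result π).greater.length = 0 by omega]
      simp [cleverBound]
    rw [Finset.sum_eq_zero fun π _ => h π]
    refine mul_nonneg hN.le ?_
    simp [cleverBound]
    linarith
  | [y], hd, hcard, hrank, hsub, hsum =>
    have h : ∀ π : Equiv.Perm (Fin n),
        cleverBound (c₀ + 1) ((partition sel 3 x [y]).result π).less.length +
        cleverBound (c₀ + 1) ((partition sel 3 x [y]).result π).greater.length =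
          12 / 7 * 2 + (c₀ + 1) := fun π => by
      have := hsum π
      simp only [List.length_cons, List.length_nil] at this
      rcases Nat.eq_zero_or_pos ((partition sel 3 x [y]).result π).less.length with h0 | h0
      · rw [h0, show ((partition sel 3 x [y]).result π).greater.length = 1 by omega]
        simp [cleverBound]
        norm_num
      · rw [show ((partition sel 3 x [y]).result π).less.length = 1 by omega,
          show ((partition sel 3 x [y]).result π).greater.length = 0 by omega]
        simp [cleverBound]
        norm_num
    rw [Finset.sum_congr rfl fun π _ => h π, Finset.sum_const, Finset.card_univ,
      Fintype.card_perm, Fintype.card_fin, nsmul_eq_mul]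
    refine mul_le_mul_of_nonneg_left ?_ hN.le
    simp [cleverBound, harmonic_succ]
    linarith
  | y :: z :: zs, hd, hcard, hrank, hsub, hsum =>
    set s := (x :: y :: z :: zs).length with hs
    have hs3 : (3 : ℝ) ≤ s := by
      exact_mod_cast (by simp [hs] : 3 ≤ s)
    have hD : 0 < (s : ℝ) * (s - 1) * (s - 2) :=
      mul_pos (mul_pos (by linarith) (by linarith)) (by linarith)
    set P : Equiv.Perm (Fin n) → Fin n :=
      fun π => ((partition sel 3 x (y :: z :: zs)).result π).pivot with hP
    have hmed := sum_rank_median_three_le (A := (x :: y :: z :: zs).toFinset) (x₁ := x) (x₂ := y)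
      (x₃ := z) (by simp) (by simp) (by simp) (by rintro rfl; simp at hd)
      (by rintro rfl; simp at hd) (by rintro rfl; simp at hd)
      (fun k => cleverBound (c₀ + 1) k + cleverBound (c₀ + 1) (s - 1 - k))
      (fun k => add_nonneg (cleverBound_nonneg hB _) (cleverBound_nonneg hB _)) P (fun π => by
        obtain ⟨h1, h2, h3⟩ : P π ∈ (x :: (y :: z :: zs).take (3 - 1)).toFinset ∧ _ ∧
          rank (· < ·) (x :: (y :: z :: zs).take (3 - 1)).toFinset π (P π) = _ :=
            partition_sample hsel 3 hd π
        have h4 := rank_lt_add_rank_gt (π := π) h1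
        have h5 : (x :: (y :: z :: zs).take (3 - 1)).toFinset = {x, y, z} := by simp
        have h6 : ((y :: z :: zs).take (3 - 1)).length = 2 := by simp
        rw [h2, h3, h6] at h4
        rw [h6] at h3
        rw [h5] at h1 h3 h4
        obtain ⟨u, hu⟩ := Finset.card_pos.1 (by simp only [rank] at h3; omega : 0 < (Finset.filter
          (fun u => π u < π (P π)) ({x, y, z} : Finset (Fin n))).card)
        obtain ⟨v, hv⟩ := Finset.card_pos.1 (by simp only [rank] at h4; omega : 0 < (Finset.filter
          (fun v => π v > π (P π)) ({x, y, z} : Finset (Fin n))).card)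
        rw [Finset.mem_filter] at hu hv
        exact ⟨u, hu.1, v, hv.1, h1, hu.2, hv.2⟩)
    rw [hcard, sum_median_cleverBound] at hmed
    have heq : ∀ π : Equiv.Perm (Fin n),
        cleverBound (c₀ + 1) ((partition sel 3 x (y :: z :: zs)).result π).less.length +
        cleverBound (c₀ + 1) ((partition sel 3 x (y :: z :: zs)).result π).greater.length =
        cleverBound (c₀ + 1) (rank (· < ·) (x :: y :: z :: zs).toFinset π (P π)) +
        cleverBound (c₀ + 1) (s - 1 - rank (· < ·) (x :: y :: z :: zs).toFinset π (P π)) :=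
      fun π => by
        have h := hsum π
        rw [← (hrank π).1]
        congr 2
        omega
    rw [Finset.sum_congr rfl fun π _ => heq π]
    refine le_of_mul_le_mul_left (hmed.trans ?_) hD
    have : n.factorial * ((s : ℝ) * (s - 1) * (s - 2) *
        (cleverBound (c₀ + 1) s - s - 19 / 7 - (c₀ + 1))) ≤ n.factorial *
        ((s : ℝ) * (s - 1) * (s - 2) * (cleverBound (c₀ + 1) s - s - c₀)) :=
      mul_le_mul_of_nonneg_left (mul_le_mul_of_nonneg_left (by linarith) hD.le) hN.le
    linarith

lemma cleverQuicksortAux_avgCost_le {c₀ : ℝ} (hc₀ : ∀ m ≤ 2, (sel m).avgCost ≤ c₀) {n : ℕ}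
    (D : DataMovement n) (fuel : ℕ) (l : List (Fin n)) (hl : l.Nodup) :
    (cleverQuicksortAux sel D fuel l).avgCost ≤ cleverBound (c₀ + 1) l.length := by
  have hc : 0 ≤ c₀ := (avgCost_nonneg _).trans (hc₀ 0 (by norm_num))
  have hB : 0 ≤ c₀ + 1 := by linarith
  induction fuel generalizing l with
  | zero =>
    have : (cleverQuicksortAux sel D 0 l).avgCost = 0 := by simp [cleverQuicksortAux, avgCost]
    rw [this]; exact cleverBound_nonneg hB _
  | succ fuel ih =>
    rcases hpick : D.pick l with _ | ⟨x, xs⟩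
    · have : (cleverQuicksortAux sel D (fuel + 1) l).avgCost = 0 := by
        rw [cleverQuicksortAux]
        simp [hpick, avgCost]
      rw [this]; exact cleverBound_nonneg hB _
    have hperm := D.pick_perm l
    rw [hpick] at hperm
    have hd : (x :: xs).Nodup := hperm.nodup_iff.2 hl
    have hlen : (x :: xs).length = l.length := hperm.length_eq
    set S : Equiv.Perm (Fin n) → Split (Fin n) := fun π => (partition sel 3 x xs).result π with hS
    have hspec := fun π : Equiv.Perm (Fin n) => partition_pick_spec hsel 3 π D hpick
    have hSmul := fun π τ t => partition_result_mul hsel 3 hd π τ (t := t)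
    have hnodup : ∀ π, (S π).less.Nodup ∧ (S π).greater.Nodup := fun π => by
      have h := (hspec π).1.nodup_iff.2 hl
      rw [List.nodup_append', List.nodup_cons] at h
      exact ⟨h.1, h.2.1.2⟩
    refine avgCost_le ?_
    have hcost : ∀ π : Equiv.Perm (Fin n),
        ((cleverQuicksortAux sel D (fuel + 1) l).cost π : ℝ) =
        ((partition sel 3 x xs).cost π : ℝ) +
          ((cleverQuicksortAux sel D fuel (D.move l (S π) [] (S π).less)).cost π +
          (cleverQuicksortAux sel D fuel (D.move l (S π) [] (S π).greater)).cost π) := fun π => by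
      rw [cleverQuicksortAux_cost hpick]
      push_cast
      rfl
    rw [Finset.sum_congr rfl fun π _ => hcost π, Finset.sum_add_distrib, Finset.sum_add_distrib,
      sum_partition_cost 3 hd,
      sum_cost_of_choice (fun π => (S π).less)
        (fun π => cleverQuicksortAux sel D fuel (D.move l (S π) [] (S π).less))
        (fun π => (hnodup π).1) (fun π => (cleverQuicksortAux_dependsOn hsel _ _ _).mono
          fun i hi => D.mem_move.1 hi) (fun π τ hτ => by
            have h : S (π * τ) = S π := hSmul π τ _ (Or.inl rfl) hτ
            simp only [h, and_self]),
      sum_cost_of_choice (fun π => (S π).greater)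
        (fun π => cleverQuicksortAux sel D fuel (D.move l (S π) [] (S π).greater))
        (fun π => (hnodup π).2) (fun π => (cleverQuicksortAux_dependsOn hsel _ _ _).mono
          fun i hi => D.mem_move.1 hi) (fun π τ hτ => by
            have h : S (π * τ) = S π := hSmul π τ _ (Or.inr rfl) hτ
            simp only [h, and_self]),
      ← Finset.sum_add_distrib]
    have b1 : ∀ π, (cleverQuicksortAux sel D fuel (D.move l (S π) [] (S π).less)).avgCost +
        (cleverQuicksortAux sel D fuel (D.move l (S π) [] (S π).greater)).avgCost ≤
        cleverBound (c₀ + 1) (S π).less.length + cleverBound (c₀ + 1) (S π).greater.length :=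
      fun π => by
        have h1 := ih (D.move l (S π) [] (S π).less)
          ((D.move_perm ..).nodup_iff.2 (hnodup π).1)
        have h2 := ih (D.move l (S π) [] (S π).greater)
          ((D.move_perm ..).nodup_iff.2 (hnodup π).2)
        rw [D.length_move] at h1 h2
        exact add_le_add h1 h2
    have b2 := (Finset.sum_le_sum fun π _ => b1 π).trans
      (sum_cleverBound_sides_le hsel hc hd)
    have b3 := hc₀ (xs.take (3 - 1)).length (by simp)
    have b4 : ((xs.drop (3 - 1)).length : ℝ) ≤ l.length := by
      rw [← hlen]
      exact_mod_cast (by rw [List.length_drop, List.length_cons]; omega :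
        (xs.drop (3 - 1)).length ≤ (x :: xs).length)
    have b5 := mul_le_mul_of_nonneg_left (add_le_add b3 b4) (Nat.cast_nonneg (α := ℝ) n.factorial)
    rw [hlen] at b2
    linarith

lemma exists_cleverQuicksort_avgCost_le (D : ∀ n, DataMovement n) :
    ∃ c : ℝ, ∀ n : ℕ, (cleverQuicksort sel D n).avgCost ≤
      12 / 7 * Real.log 2 * ((n : ℝ) * Real.logb 2 n) + c * n := by
  have hc₀ : ∀ m ≤ 2, (sel m).avgCost ≤ ∑ i ∈ Finset.range 3, (sel i).avgCost := fun m hm =>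
    Finset.single_le_sum (f := fun i => (sel i).avgCost) (fun _ _ => avgCost_nonneg _)
      (Finset.mem_range.2 (by omega))
  set c₀ := ∑ i ∈ Finset.range 3, (sel i).avgCost
  refine ⟨36 / 7 + (c₀ + 1), fun n => ?_⟩
  have h1 := cleverQuicksortAux_avgCost_le hsel hc₀ (D n) n (List.finRange n)
    (List.nodup_finRange n)
  rw [List.length_finRange] at h1
  refine h1.trans ?_
  rcases Nat.eq_zero_or_pos n with rfl | hn
  · simp [cleverBound]
  have hn' : (1 : ℝ) ≤ n := by exact_mod_cast hn
  have h2 : (harmonic n : ℝ) ≤ 1 + Real.log n := harmonic_le_one_add_log n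
  have h3 : Real.log n ≤ n - 1 := Real.log_le_sub_one_of_pos (by linarith)
  have h4 : Real.log 2 * Real.logb 2 n = Real.log n := by
    unfold Real.logb
    have := (Real.log_pos (by norm_num : (1 : ℝ) < 2)).ne'
    field_simp
  have h5 : ((n : ℝ) + 1) * (harmonic n : ℝ) ≤ (n + 1) * (1 + Real.log n) :=
    mul_le_mul_of_nonneg_left h2 (by linarith)
  have h6 : 12 / 7 * Real.log 2 * ((n : ℝ) * Real.logb 2 n) = 12 / 7 * (n * Real.log n) := by
    rw [← h4]; ring
  unfold cleverBound
  rw [h6]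
  linarith

end CleverQuicksort

/-! ### QuickMergeXsort -/

section QuickMergeXsort

variable {sel : MedianFinder} (hsel : ∀ m, (sel m).FindsMedian)
  (hselCost : (fun m : ℕ => (sel m).avgCost) =O[atTop] fun m : ℕ => (m : ℝ) ^ 2)
  {sampleSize : ℕ → ℕ}
  (hsample : (sampleSize = fun n : ℕ => ⌈√(n : ℝ)⌉₊) ∨ (sampleSize = fun _ : ℕ => 3))

include hsample in
/-- Both sample sizes are so small that quadratic costs on the sample are linear costs. -/
lemma sq_le_of_le_sampleSize {s m : ℕ} (hs : 1 ≤ s) (hm : m + 1 ≤ max 1 (sampleSize s)) :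
    ((m : ℝ) + 1) ^ 2 ≤ 9 * s := by
  have hs' : (1 : ℝ) ≤ s := by exact_mod_cast hs
  rcases hsample with rfl | rfl
  · have h1 : (1 : ℝ) ≤ √(s : ℝ) := Real.one_le_sqrt.2 hs'
    have h2 : (m : ℝ) + 1 ≤ ⌈√(s : ℝ)⌉₊ := by
      have h : 1 ≤ ⌈√(s : ℝ)⌉₊ := Nat.one_le_ceil_iff.2 (by linarith)
      simp only [max_eq_right h] at hm
      exact_mod_cast hm
    have h3 := Nat.ceil_lt_add_one (Real.sqrt_nonneg (s : ℝ))
    have h4 : (m : ℝ) + 1 ≤ 2 * √(s : ℝ) := by linarith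
    have h5 := Real.sq_sqrt (by linarith : (0 : ℝ) ≤ s)
    have h6 : (0 : ℝ) ≤ m := Nat.cast_nonneg m
    nlinarith
  · have h2 : (m : ℝ) + 1 ≤ 3 := by
      exact_mod_cast (by simpa using hm : m + 1 ≤ 3)
    have h6 : (0 : ℝ) ≤ m := Nat.cast_nonneg m
    nlinarith

include hsel hselCost hsample

lemma exists_quickMergeXsort_avgCost_le {X : Sorter} {α c β : ℝ} {r : ℕ → ℝ} (hβ : 0 < β)
    (hX : ∀ n, (X n).Sorts) (hr : r =o[atTop] (fun n : ℕ => (n : ℝ)))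
    (hcost : ∀ᶠ n : ℕ in atTop,
      (X n).avgCost ≤ α * ((n : ℝ) * Real.logb 2 n) + c * (n : ℝ) + r n) :
    ∃ C : ℝ, ∀ (n : ℕ) (D : DataMovement n) (useLess : ℕ → ℕ → Bool)
      (callX : ℕ → ℕ → ℕ → Bool), StopsAtPower β n callX →
      (quickMergeXsort sel sampleSize X n D useLess callX).avgCost ≤
        (α * β + (1 - β)) * ((n : ℝ) * Real.logb 2 n) + C * (n : ℝ) := by
  have hcost' : ∀ᶠ n : ℕ in atTop,
      (X n).avgCost ≤ α * ((n : ℝ) * Real.logb 2 n) + (c + 1) * n := by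
    filter_upwards [hcost, hr.bound one_pos] with n h1 h2
    rw [Real.norm_natCast, one_mul] at h2
    linarith [Real.le_norm_self (r n)]
  have hα : 1 ≤ α := one_le_of_avgCost_le hX hcost'
  have hlogb : ∀ n : ℕ, 0 ≤ Real.logb 2 n := fun n => by
    rcases Nat.eq_zero_or_pos n with rfl | hn
    · simp
    · exact Real.logb_nonneg (by norm_num) (by exact_mod_cast hn)
  obtain ⟨CX, hCX, hXle⟩ := exists_forall_le_add_mul (f := fun n => (X n).avgCost)
    (g := fun n : ℕ => α * ((n : ℝ) * Real.logb 2 n)) (avgCost_zero _).le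
    (fun n => mul_nonneg (by linarith) (mul_nonneg (Nat.cast_nonneg _) (hlogb n))) hcost'
  obtain ⟨Cs, hCs, hsle⟩ := exists_sel_avgCost_le hselCost
  refine ⟨α + CX + 16 * (9 * Cs + 1), fun n D useLess callX hcallX => ?_⟩
  rcases Nat.eq_zero_or_pos n with rfl | hn
  · rw [avgCost_zero]; simp
  have hn' : (1 : ℝ) ≤ n := by exact_mod_cast hn
  set N := ⌈(n : ℝ) ^ β⌉₊
  have hpow : (1 : ℝ) ≤ (n : ℝ) ^ β := Real.one_le_rpow hn' hβ.le
  have hN : 0 < N := Nat.ceil_pos.2 (by linarith)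
  have hlogN : Real.logb 2 N ≤ 1 + β * Real.logb 2 n := by
    have h1 : (N : ℝ) ≤ 2 * (n : ℝ) ^ β := by
      have := Nat.ceil_lt_add_one (by linarith : 0 ≤ (n : ℝ) ^ β)
      linarith
    have h2 := Real.logb_le_logb_of_le (b := 2) (by norm_num) (by exact_mod_cast hN) h1
    rwa [Real.logb_mul (by norm_num) (by linarith), Real.logb_self_eq_one (by norm_num),
      Real.logb_rpow_eq_mul_logb_of_pos (by linarith)] at h2
  set γ := (α * β + (1 - β)) * Real.logb 2 n + α + CX with hγ
  have hγ' : γ = Real.logb 2 n + 1 + ((α - 1) * (1 + β * Real.logb 2 n) + CX) := by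
    rw [hγ]; ring
  have hγ0 : 0 ≤ γ := by
    have h1 := mul_nonneg (sub_nonneg.2 hα) (by
      have := mul_nonneg hβ.le (hlogb n); linarith : 0 ≤ 1 + β * Real.logb 2 n)
    rw [hγ']
    linarith [hlogb n]
  have hmerge : ∀ m ≤ n, ∀ l : List (Fin n), l.Nodup → l.length = m →
      (mergeXsort X (callX m) 0 l).avgCost ≤ γ * l.length := by
    intro m hm l hl hlm
    have h1 := mergeXsort_avgCost_le hX hα (fun n => by simpa using hXle n) hN (callX m)
      (fun d s h => (hcallX m d s hm).1 h) 0 l hl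
    refine h1.trans ?_
    rcases Nat.eq_zero_or_pos l.length with h0 | h0
    · simp [h0]
    have h2 := clog_le_logb_add_one h0
    have h3 : Real.logb 2 l.length ≤ Real.logb 2 n :=
      Real.logb_le_logb_of_le (by norm_num) (by exact_mod_cast h0) (by exact_mod_cast hlm ▸ hm)
    have h4 := mul_le_mul_of_nonneg_left hlogN (sub_nonneg.2 hα)
    rw [mul_comm]
    refine mul_le_mul_of_nonneg_right ?_ (Nat.cast_nonneg _)
    linarith
  have hpart : ∀ s m j : ℕ, m + j + 1 = s → m + 1 ≤ max 1 (sampleSize s) →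
      (sel m).avgCost + j ≤ 16 * (9 * Cs + 1) / 16 * s := by
    intro s m j hs hm
    have h1 := mul_le_mul_of_nonneg_left (sq_le_of_le_sampleSize hsample (by omega) hm) hCs
    have h2 : (j : ℝ) ≤ s := by exact_mod_cast (by omega : j ≤ s)
    linarith [hsle m]
  have := quickMergeXsortAux_avgCost_le hsel sampleSize hX D useLess callX hγ0
    (by positivity : 0 ≤ 16 * (9 * Cs + 1)) hmerge hpart n (List.finRange n)
    (List.nodup_finRange n)
  rw [List.length_finRange] at this
  refine this.trans (le_of_eq ?_)
  rw [hγ]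
  ring

end QuickMergeXsort

end QuickMergeX

open QuickMergeX in
theorem theorem3
    (sel : MedianFinder) (hsel : ∀ m, (sel m).FindsMedian)
    (hselCost : (fun m : ℕ => (sel m).avgCost) =O[atTop] fun m : ℕ => (m : ℝ) ^ 2)
    (sampleSize : ℕ → ℕ)
    (hsample : (sampleSize = fun n : ℕ => ⌈√(n : ℝ)⌉₊) ∨ (sampleSize = fun _ : ℕ => 3)) :
    (∀ (X : Sorter) (α c β : ℝ) (r : ℕ → ℝ), 0 < β → β < 1 →
      (∀ n, (X n).Sorts) →
      r =o[atTop] (fun n : ℕ => (n : ℝ)) →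
      (∀ᶠ n : ℕ in atTop,
        (X n).avgCost ≤ α * ((n : ℝ) * Real.logb 2 n) + c * (n : ℝ) + r n) →
      ∃ C : ℝ, ∀ (n : ℕ) (D : DataMovement n) (useLess : ℕ → ℕ → Bool)
        (callX : ℕ → ℕ → ℕ → Bool), StopsAtPower β n callX →
        (quickMergeXsort sel sampleSize X n D useLess callX).Sorts ∧
        (quickMergeXsort sel sampleSize X n D useLess callX).avgCost ≤
          (α * β + (1 - β)) * ((n : ℝ) * Real.logb 2 n) + C * (n : ℝ)) ∧
    (∀ E : ∀ n, DataMovement n,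
      ∃ C : ℝ, ∀ (n : ℕ) (D : DataMovement n) (useLess : ℕ → ℕ → Bool)
        (callX : ℕ → ℕ → ℕ → Bool), StopsAtPower (1 / 2) n callX →
        (quickMergeXsort sel sampleSize (cleverQuicksort sel E) n D useLess callX).Sorts ∧
        (quickMergeXsort sel sampleSize (cleverQuicksort sel E) n D useLess callX).avgCost ≤
          ((1 + 12 / 7 * Real.log 2) / 2) * ((n : ℝ) * Real.logb 2 n) + C * (n : ℝ)) ∧
    |(1 + 12 / 7 * Real.log 2) / 2 - 1.094| < (1 / 2000 : ℝ) := by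
  refine ⟨fun X α c β r hβ _ hX hr hcost => ?_, fun E => ?_, ?_⟩
  · obtain ⟨C, hC⟩ := exists_quickMergeXsort_avgCost_le hsel hselCost hsample hβ hX hr hcost
    exact ⟨C, fun n D useLess callX hcallX =>
      ⟨quickMergeXsort_sorts hsel sampleSize hX D useLess callX, hC n D useLess callX hcallX⟩⟩
  · have hX := cleverQuicksort_sorts hsel E
    obtain ⟨c, hc⟩ := exists_cleverQuicksort_avgCost_le hsel E
    obtain ⟨C, hC⟩ := exists_quickMergeXsort_avgCost_le hsel hselCost hsample one_half_pos hX
      (isLittleO_zero _ _) (Eventually.of_forall fun n => by simpa using hc n)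
    refine ⟨C, fun n D useLess callX hcallX =>
      ⟨quickMergeXsort_sorts hsel sampleSize hX D useLess callX, ?_⟩⟩
    refine (hC n D useLess callX hcallX).trans (le_of_eq ?_)
    ring
  · rw [abs_lt]
    constructor <;> linarith [Real.log_two_gt_d9, Real.log_two_lt_d9]
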